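/- Work in first-order logic with equality in the language of set theory $\{\in\}$. Let $\Sigma_0=\Pi_0=\Delta_0$ be the class of formulae built from atomic formulae by propositional connectives and bounded quantifiers $\forall x\in y$, $\exists x\in y$; a $\Sigma_{l+1}$-formula ($\Pi_{l+1}$-formula) is a block of existential (universal) quantifiers followed by a $\Pi_l$-formula ($\Sigma_l$-formula). For a class $\Gamma$ of formulae: * $\Gamma$-Separation: $\forall\vec z\,\forall w\,\exists y\,\forall x\,(x\in y\leftrightarrow x\in w\wedge\phi(x,\vec z))$, for all $\phi\in\Gamma$. * $\Gamma$-Collection: $\forall\vec z\,\forall w\,\big((\forall x\in w)\exists y\,\phi(x,y,\vec z)\rightarrow\exists c\,(\forall x\in w)(\exists y\in c)\,\phi(x,y,\vec z)\big)$, for all $\phi\in\Gamma$. * $\Gamma$-Foundation: $\forall\vec z\,\big(\exists x\,\phi(x,\vec z)\rightarrow\exists y(\phi(y,\vec z)\wedge(\forall w\in y)\neg\phi(w,\vec z))\big)$, for all $\phi\in\Gamma$. Set-Foundation is the single instance $\phi(x,z):\; x\in z$. $\mathsf{KP}$ is the theory with axioms Extensionality, Emptyset, Pair, Union, Set Difference,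 $\Delta_0$-Separation, $\Delta_0$-Collection and $\Pi_1$-Foundation (no axiom of Infinity). $\mathsf{M}$ is the theory with axioms Extensionality, Emptyset, Pair, Union, Set Difference, Powerset, Infinity (there is a superset of the von Neumann ordinal $\omega$), $\mathsf{TCo}$ (every set is contained in a transitive set), $\Delta_0$-Separation and Set-Foundation. For a formula $\phi(x,y,\vec z)$ let $\delta_\omega^\phi(b,f,\vec z)$ be the formula saying that $f$ is a function with $\mathrm{dom}(f)=\omega$ and $f(0)=\{b\}$, and that for all $u\in\omega$, $(\forall x\in f(u))(\exists y\in f(u+1))\,\phi(x,y,\vec z)$ and $(\forall y\in f(u+1))(\exists x\in f(u))\,\phi(x,y,\vec z)$ (that is, $f$ is a family of directed paths of length $\omega$ that starts at $b$ in the directed graph defined by $\phi$). For $l\ge 1$, $\Delta_l\text{-}\mathsf{WDC}_\omega$ is the scheme consisting of $$\forall\vec z\,\Big(\forall x\forall y\,(\phi(x,y,\vec z)\leftrightarrow\psi(x,y,\vec z))\rightarrow\big(\forall x\exists y\,\phi(x,y,\vec z)\rightarrow\forall w\,\exists f\,\delta_\omega^\phi(w,f,\vec z)\big)\Big)$$ for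 all $\Pi_l$-formulae $\phi(x,y,\vec z)$ and all $\Sigma_l$-formulae $\psi(x,y,\vec z)$. **Theorem.** Let $n\in\omega$ with $n\ge 1$. 1. The theory $\mathsf{KP}+\Pi_{n-1}\text{-Collection}+\Sigma_n\text{-Foundation}+\Delta_{n+1}\text{-}\mathsf{WDC}_\omega$ proves $\Sigma_{n+1}\text{-Foundation}$. 2. The theory $\mathsf{M}+\Pi_n\text{-Collection}+\Pi_{n+1}\text{-Foundation}$ proves $\Delta_{n+1}\text{-}\mathsf{WDC}_\omega$. Here a theory $T$ proves a scheme if every sentence of the scheme is a logical consequence of $T$, i.e. is true in every model of $T$ (equivalently, by Gödel's completeness theorem, is derivable from $T$). -/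

import Mathlib

open FirstOrder FirstOrder.Language

namespace LevySet

/-! ### The language of set theory -/

/-- The only non-logical symbol of the language of set theory: the binary relation `∈`. -/
inductive MemRel : ℕ → Type
  | mem : MemRel 2

/-- The language of set theory. -/
def LSet : FirstOrder.Language.{0, 0} := ⟨fun _ => Empty, MemRel⟩

/-- The symbol `∈`. -/
def memSym : LSet.Relations 2 := MemRel.mem

/-- The most recently bound variable. -/
def new {α : Type} {n : ℕ} : α ⊕ Fin (n + 1) := Sum.inr (Fin.last n)

/-- A variable, seen from inside one more quantifier. -/
def up {α : Type} {n : ℕ} (a : α ⊕ Fin n) : α ⊕ Fin (n + 1) := Sum.map id Fin.castSucc a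

/-- `a ∈ b` -/
def memF {α : Type} {n : ℕ} (a b : α ⊕ Fin n) : LSet.BoundedFormula α n :=
  memSym.boundedFormula₂ (Term.var a) (Term.var b)

/-- `a = b` -/
def eqF {α : Type} {n : ℕ} (a b : α ⊕ Fin n) : LSet.BoundedFormula α n :=
  Term.bdEqual (L := LSet) (Term.var a) (Term.var b)

/-- `(∀ x ∈ a) φ` -/
def ballF {α : Type} {n : ℕ} (a : α ⊕ Fin n) (φ : LSet.BoundedFormula α (n + 1)) :
    LSet.BoundedFormula α n :=
  ∀' (memF new (up a) ⟹ φ)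

/-- `(∃ x ∈ a) φ` -/
def bexF {α : Type} {n : ℕ} (a : α ⊕ Fin n) (φ : LSet.BoundedFormula α (n + 1)) :
    LSet.BoundedFormula α n :=
  ∃' (memF new (up a) ⊓ φ)

/-! ### The Lévy hierarchy -/

/-- A class of formulae of the language of set theory. -/
abbrev FmlClass := ∀ (α : Type) (n : ℕ), LSet.BoundedFormula α n → Prop

/-- `Δ₀`-formulae: the least class that contains the atomic formulae and is closed under
propositional connectives and bounded quantification. (The connectives `¬`, `∧`, `∨`, `↔` are
abbreviations built from `⊥` and `→`.) -/
inductive Delta0 (α : Type) : ∀ n : ℕ, LSet.BoundedFormula α n → Prop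
  | falsum {n : ℕ} : Delta0 α n ⊥
  | eq {n : ℕ} (a b : α ⊕ Fin n) : Delta0 α n (eqF a b)
  | mem {n : ℕ} (a b : α ⊕ Fin n) : Delta0 α n (memF a b)
  | imp {n : ℕ} {φ ψ : LSet.BoundedFormula α n} :
      Delta0 α n φ → Delta0 α n ψ → Delta0 α n (φ ⟹ ψ)
  | ball {n : ℕ} (a : α ⊕ Fin n) {φ : LSet.BoundedFormula α (n + 1)} :
      Delta0 α (n + 1) φ → Delta0 α n (ballF a φ)
  | bex {n : ℕ} (a : α ⊕ Fin n) {φ : LSet.BoundedFormula α (n + 1)} :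
      Delta0 α (n + 1) φ → Delta0 α n (bexF a φ)

/-- Formulae `∃ u₁ ⋯ ∃ uₘ φ`, `m ≥ 0`, with `φ` in `Γ`. -/
inductive ExBlock (Γ : FmlClass) (α : Type) : ∀ n : ℕ, LSet.BoundedFormula α n → Prop
  | base {n : ℕ} {φ : LSet.BoundedFormula α n} : Γ α n φ → ExBlock Γ α n φ
  | ex {n : ℕ} {φ : LSet.BoundedFormula α (n + 1)} :
      ExBlock Γ α (n + 1) φ → ExBlock Γ α n (∃' φ)

/-- Formulae `∀ u₁ ⋯ ∀ uₘ φ`, `m ≥ 0`, with `φ` in `Γ`. -/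
inductive AllBlock (Γ : FmlClass) (α : Type) : ∀ n : ℕ, LSet.BoundedFormula α n → Prop
  | base {n : ℕ} {φ : LSet.BoundedFormula α n} : Γ α n φ → AllBlock Γ α n φ
  | all {n : ℕ} {φ : LSet.BoundedFormula α (n + 1)} :
      AllBlock Γ α (n + 1) φ → AllBlock Γ α n (∀' φ)

mutual
/-- `Σₗ`-formulae, with `Σ₀ = Δ₀`. -/
def SigmaFml : ℕ → FmlClass
  | 0 => Delta0
  | l + 1 => ExBlock (PiFml l)
/-- `Πₗ`-formulae, with `Π₀ = Δ₀`. -/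
def PiFml : ℕ → FmlClass
  | 0 => Delta0
  | l + 1 => AllBlock (SigmaFml l)
end

/-! ### Some formulae of set theory -/

/-- `a = ∅` -/
def emptyF {α : Type} {n : ℕ} (a : α ⊕ Fin n) : LSet.BoundedFormula α n :=
  ∀' ∼(memF new (up a))

/-- `a ⊆ b` -/
def subF {α : Type} {n : ℕ} (a b : α ⊕ Fin n) : LSet.BoundedFormula α n :=
  ballF a (memF new (up b))

/-- `p = {a, b}` -/
def pairF {α : Type} {n : ℕ} (p a b : α ⊕ Fin n) : LSet.BoundedFormula α n :=
  ∀' (memF new (up p) ⇔ (eqF new (up a) ⊔ eqF new (up b)))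

/-- `p = {a}` -/
def singF {α : Type} {n : ℕ} (p a : α ⊕ Fin n) : LSet.BoundedFormula α n :=
  ∀' (memF new (up p) ⇔ eqF new (up a))

/-- `p = ⟨a, b⟩`, that is, `p = {{a}, {a, b}}` -/
def opairF {α : Type} {n : ℕ} (p a b : α ⊕ Fin n) : LSet.BoundedFormula α n :=
  ∀' (memF new (up p) ⇔ (singF new (up a) ⊔ pairF new (up a) (up b)))

/-- `s = u ∪ {u}` -/
def succF {α : Type} {n : ℕ} (s u : α ⊕ Fin n) : LSet.BoundedFormula α n :=
  ∀' (memF new (up s) ⇔ (memF new (up u) ⊔ eqF new (up u)))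

/-- `a` is transitive. -/
def transF {α : Type} {n : ℕ} (a : α ⊕ Fin n) : LSet.BoundedFormula α n :=
  ballF a (subF new (up a))

/-- `a` is an ordinal: a transitive set of transitive sets. -/
def ordF {α : Type} {n : ℕ} (a : α ⊕ Fin n) : LSet.BoundedFormula α n :=
  transF a ⊓ ballF a (transF new)

/-- `y` is empty or a successor. -/
def zeroOrSuccF {α : Type} {n : ℕ} (y : α ⊕ Fin n) : LSet.BoundedFormula α n :=
  emptyF y ⊔ bexF y (succF (up y) new)

/-- `a ∈ ω`: `a` is an ordinal such that `a` and each element of `a` is zero or a successor. -/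
def natF {α : Type} {n : ℕ} (a : α ⊕ Fin n) : LSet.BoundedFormula α n :=
  ordF a ⊓ (zeroOrSuccF a ⊓ ballF a (zeroOrSuccF new))

/-- `⟨a, b⟩ ∈ f`; when `f` is a function, this says `f(a) = b`. -/
def valF {α : Type} {n : ℕ} (f a b : α ⊕ Fin n) : LSet.BoundedFormula α n :=
  bexF f (opairF new (up a) (up b))

/-- `f` is a function: a single-valued set of ordered pairs. -/
def funF {α : Type} {n : ℕ} (f : α ⊕ Fin n) : LSet.BoundedFormula α n :=
  ballF f (∃' ∃' (opairF (up (up new)) (up new) new)) ⊓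
  ∀' ∀' ∀' ((valF (up (up (up f))) (up (up new)) (up new) ⊓
    valF (up (up (up f))) (up (up new)) new) ⟹ eqF (up new) new)

/-- `dom(f) = ω` -/
def domOmegaF {α : Type} {n : ℕ} (f : α ⊕ Fin n) : LSet.BoundedFormula α n :=
  ∀' (natF new ⇔ ∃' (valF (up (up f)) (up new) new))

/-! ### Axioms and axiom schemes -/

/-- `φ(v₁, …, vₘ, z⃗)`, for `φ` a formula with parameter variables `z⃗` (of type `Fin k`) and
`m` further variables. -/
def inst {k m n : ℕ} (φ : LSet.Formula (Fin k ⊕ Fin m)) (v : Fin m → Fin k ⊕ Fin n) :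
    LSet.BoundedFormula (Fin k) n :=
  BoundedFormula.relabel (Sum.elim Sum.inl v) φ

/-- The universal closure `∀ z⃗ φ(z⃗)`. -/
def closure {k : ℕ} (φ : LSet.Formula (Fin k)) : LSet.Sentence :=
  BoundedFormula.alls (n := k) (BoundedFormula.relabel (Sum.inr : Fin k → Empty ⊕ Fin k) φ)

/-- Two sets with the same elements are equal. -/
def extensionality : LSet.Sentence :=
  ∀' ∀' ((∀' (memF new (up (up new)) ⇔ memF new (up new))) ⟹ eqF (up new) new)

/-- There is an empty set. -/
def emptyset : LSet.Sentence := ∃' (emptyF new)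

/-- `{x, y}` exists. -/
def pairing : LSet.Sentence := ∀' ∀' ∃' (pairF new (up (up new)) (up new))

/-- `⋃ x` exists. -/
def union : LSet.Sentence :=
  ∀' ∃' ∀' (memF new (up new) ⇔ bexF (up (up new)) (memF (up new) new))

/-- `x \ y` exists. -/
def setDifference : LSet.Sentence :=
  ∀' ∀' ∃' ∀' (memF new (up new) ⇔
    (memF new (up (up (up new))) ⊓ ∼(memF new (up (up new)))))

/-- The set of all subsets of `x` exists. -/
def powerset : LSet.Sentence :=
  ∀' ∃' ∀' (memF new (up new) ⇔ subF new (up (up new)))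

/-- A superset of the von Neumann ordinal `ω` exists. -/
def infinity : LSet.Sentence := ∃' ∀' (natF new ⟹ memF new (up new))

/-- Every set is contained in a transitive set. -/
def TCo : LSet.Sentence := ∀' ∃' (transF new ⊓ subF (up new) new)

/-- Every nonempty set `z` has an element `y` none of whose elements is in `z`. -/
def setFoundation : LSet.Sentence :=
  ∀' ((∃' (memF new (up new))) ⟹ bexF new (ballF new (∼(memF new (up (up new))))))

/-- `Γ`-Separation: `∀ z⃗ ∀ w ∃ y ∀ x (x ∈ y ↔ x ∈ w ∧ φ(x, z⃗))` for `φ` in `Γ`. -/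
def Separation (Γ : FmlClass) : LSet.Theory :=
  {σ | ∃ (k : ℕ) (φ : LSet.Formula (Fin k ⊕ Fin 1)), Γ _ _ φ ∧ σ = closure
    (∀' ∃' ∀' (memF new (up new) ⇔ (memF new (up (up new)) ⊓ inst φ ![new])))}

/-- `Γ`-Collection: `∀ z⃗ ∀ w ((∀ x ∈ w) ∃ y φ(x, y, z⃗) → ∃ c (∀ x ∈ w) (∃ y ∈ c) φ(x, y, z⃗))`
for `φ` in `Γ`. -/
def Collection (Γ : FmlClass) : LSet.Theory :=
  {σ | ∃ (k : ℕ) (φ : LSet.Formula (Fin k ⊕ Fin 2)), Γ _ _ φ ∧ σ = closure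
    (∀' (ballF new (∃' (inst φ ![up new, new])) ⟹
      ∃' (ballF (up new) (bexF (up new) (inst φ ![up new, new])))))}

/-- `Γ`-Foundation: `∀ z⃗ (∃ x φ(x, z⃗) → ∃ y (φ(y, z⃗) ∧ (∀ w ∈ y) ¬ φ(w, z⃗)))`
for `φ` in `Γ`. -/
def Foundation (Γ : FmlClass) : LSet.Theory :=
  {σ | ∃ (k : ℕ) (φ : LSet.Formula (Fin k ⊕ Fin 1)), Γ _ _ φ ∧ σ = closure
    ((∃' (inst φ ![new])) ⟹ ∃' (inst φ ![new] ⊓ ballF new (∼(inst φ ![new]))))}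

/-- `(∀ x ∈ X)(∃ y ∈ Y) φ(x, y, z⃗) ∧ (∀ y ∈ Y)(∃ x ∈ X) φ(x, y, z⃗)` -/
def linkF {k n : ℕ} (φ : LSet.Formula (Fin k ⊕ Fin 2)) (X Y : Fin k ⊕ Fin n) :
    LSet.BoundedFormula (Fin k) n :=
  ballF X (bexF (up Y) (inst φ ![up new, new])) ⊓
  ballF Y (bexF (up X) (inst φ ![new, up new]))

/-- `f(0) = {b}` -/
def startF {α : Type} {n : ℕ} (b f : α ⊕ Fin n) : LSet.BoundedFormula α n :=
  ∃' ∃' (emptyF (up new) ⊓ (singF new (up (up b)) ⊓ valF (up (up f)) (up new) new))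

/-- `(∀ x ∈ f(u))(∃ y ∈ f(u+1)) φ(x, y, z⃗) ∧ (∀ y ∈ f(u+1))(∃ x ∈ f(u)) φ(x, y, z⃗)`: here
`s`, `X`, `Y` are bound in this order, with `s = u + 1`, `X = f(u)` and `Y = f(s)`. -/
def stepF {k n : ℕ} (φ : LSet.Formula (Fin k ⊕ Fin 2)) (f u : Fin k ⊕ Fin n) :
    LSet.BoundedFormula (Fin k) n :=
  ∀' ∀' ∀' ((succF (up (up new)) (up (up (up u))) ⊓
    (valF (up (up (up f))) (up (up (up u))) (up new) ⊓
      valF (up (up (up f))) (up (up new)) new)) ⟹ linkF φ (up new) new)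

/-- `δ_ω^φ(b, f, z⃗)`: `f` is a function with domain `ω`, `f(0) = {b}`, and for all `u ∈ ω`,
`(∀ x ∈ f(u))(∃ y ∈ f(u+1)) φ(x, y, z⃗)` and `(∀ y ∈ f(u+1))(∃ x ∈ f(u)) φ(x, y, z⃗)`. -/
def deltaOmegaF {k n : ℕ} (φ : LSet.Formula (Fin k ⊕ Fin 2)) (b f : Fin k ⊕ Fin n) :
    LSet.BoundedFormula (Fin k) n :=
  funF f ⊓ (domOmegaF f ⊓ (startF b f ⊓ ∀' (natF new ⟹ stepF φ (up f) new)))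

/-- `Δₗ-WDC_ω`: for all `Πₗ`-formulae `φ(x, y, z⃗)` and all `Σₗ`-formulae `ψ(x, y, z⃗)`,
`∀ z⃗ (∀ x ∀ y (φ(x, y, z⃗) ↔ ψ(x, y, z⃗)) →
  (∀ x ∃ y φ(x, y, z⃗) → ∀ w ∃ f δ_ω^φ(w, f, z⃗)))`. -/
def DeltaWDC (l : ℕ) : LSet.Theory :=
  {σ | ∃ (k : ℕ) (φ ψ : LSet.Formula (Fin k ⊕ Fin 2)), PiFml l _ _ φ ∧ SigmaFml l _ _ ψ ∧ σ = closure
    ((∀' ∀' (inst φ ![up new, new] ⇔ inst ψ ![up new, new])) ⟹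
      ((∀' ∃' (inst φ ![up new, new])) ⟹ ∀' ∃' (deltaOmegaF φ (up new) new)))}

/-- Kripke-Platek set theory (without Infinity, and with Foundation for `Π₁`-formulae only). -/
def KP : LSet.Theory :=
  {extensionality, emptyset, pairing, union, setDifference} ∪
    Separation Delta0 ∪ Collection Delta0 ∪ Foundation (PiFml 1)

/-- The theory `M`. -/
def theoryM : LSet.Theory :=
  {extensionality, emptyset, pairing, union, setDifference, powerset, infinity, TCo,
    setFoundation} ∪ Separation Delta0

/-- `T` proves every sentence of the scheme `S`. -/
def Proves (T S : LSet.Theory) : Prop := ∀ σ ∈ S, T ⊨ᵇ σ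

end LevySet

/-!
The proof works inside an arbitrary model `M` of the theory in question. The Lévy classes are
replaced by classes `IsSigma`, `IsPi`, `IsDelta` of predicates on `M` with parameters, which are
closed under substitution, connectives and the appropriate quantifiers; `isSigma_isPi_realize` and
`IsSigma.hasFormula` translate between formulae and such predicates, so that the schemes become
statements about definable predicates. `Πₙ`-Collection makes the `Πₗ`-predicates closed under
bounded quantification for all `l ≤ n + 1` (`piBounded_of_collFor`).

*Foundation from dependent choice* (`foundFor_sigma_succ`). Suppose that `∃ u S x u`, with `S` a
`Πₙ`-relation, holds of some `x` and has no `∈`-minimal instance. Let `P p` say that `p = ⟨x, u⟩`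
with `S x u`. The relation "if `P p`, then `P q` and the first coordinate of `q` is an element of
that of `p`" is a Boolean combination of `Πₙ`-predicates, and total. Dependent choice gives a
family of paths that starts at a pair satisfying `P`. By `Σₙ`-Foundation along `ω`, all its vertices
satisfy `P`, so the first coordinates of the vertices form a `Σ₁`-class without `∈`-minimal
element, against `Σₙ`-Foundation.

*Dependent choice from collection* (`wdcFor_of_collFor`). `Πₙ`-Collection yields
`Σₙ`-Separation, hence `Δₙ₊₁`-Separation, and `Σₙ₊₁`-Collection. Powerset,
collection and `Π₂`-Foundation show that every set is included in a level of the cumulative hierarchy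
(`exists_level`), and the levels are linearly ordered by `∈` (`IsHistory.comparable`). So, for a
total `Δₙ₊₁`-relation `R`, a set `X` has a definite next set `Y`: the set of all `R`-successors of
elements of `X` in the least level that contains a successor of each element of `X`. This function
has a `Δₙ₊₁` graph, and iterating it along `ω` from `{b}` gives the family of paths. The iteration
(`exists_recursion`) uses `Πₙ₊₁`-Foundation for the existence of its finite stages, collection to
bound them, and Set-Foundation for uniqueness.
-/

set_option linter.unusedSectionVars false

namespace LevySet

/-! ### Membership in a structure and the meaning of the basic formulae -/

@[simp] theorem elim_new {M α : Type} {n : ℕ} (v : α → M) (xs : Fin n → M) (y : M) :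
    Sum.elim v (Fin.snoc xs y : Fin (n + 1) → M) new = y := by
  simp [new]

@[simp] theorem elim_up {M α : Type} {n : ℕ} (v : α → M) (xs : Fin n → M) (y : M)
    (a : α ⊕ Fin n) :
    Sum.elim v (Fin.snoc xs y : Fin (n + 1) → M) (up a) = Sum.elim v xs a := by
  cases a <;> simp [up]

section Semantics

variable {M : Type} [LSet.Structure M]

/-- The interpretation of `∈` in the structure `M`. -/
def E (x y : M) : Prop := Structure.RelMap memSym ![x, y]

infix:50 " ε " => E

/-- `x ⊆ y` -/
def Sub (x y : M) : Prop := ∀ z, z ε x → z ε y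

/-- `p = {a}` -/
def IsSing (p a : M) : Prop := ∀ z, z ε p ↔ z = a

/-- `p = {a, b}` -/
def IsPair (p a b : M) : Prop := ∀ z, z ε p ↔ (z = a ∨ z = b)

/-- `p = ⟨a, b⟩` -/
def IsOp (p a b : M) : Prop := ∀ z, z ε p ↔ (IsSing z a ∨ IsPair z a b)

/-- `a = ∅` -/
def IsEmpt (a : M) : Prop := ∀ z, ¬ z ε a

/-- `s = u ∪ {u}` -/
def IsSucc (s u : M) : Prop := ∀ z, z ε s ↔ (z ε u ∨ z = u)

/-- `a` is transitive. -/
def IsTrans (a : M) : Prop := ∀ z, z ε a → Sub z a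

/-- `y` is empty or a successor. -/
def ZeroOrSucc (y : M) : Prop := IsEmpt y ∨ ∃ z, z ε y ∧ IsSucc y z

/-- `a ∈ ω` -/
def IsNat (a : M) : Prop :=
  (IsTrans a ∧ ∀ z, z ε a → IsTrans z) ∧ ZeroOrSucc a ∧ ∀ z, z ε a → ZeroOrSucc z

/-- `⟨a, b⟩ ∈ f` -/
def Val (f a b : M) : Prop := ∃ p, p ε f ∧ IsOp p a b

section Realize

variable {α : Type} {n : ℕ} (v : α → M) (xs : Fin n → M)

@[simp] theorem realize_memF (a b : α ⊕ Fin n) :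
    (memF a b).Realize v xs ↔ Sum.elim v xs a ε Sum.elim v xs b := by
  simp [memF, E]

@[simp] theorem realize_eqF (a b : α ⊕ Fin n) :
    (eqF a b).Realize v xs ↔ Sum.elim v xs a = Sum.elim v xs b := by
  simp [eqF]

@[simp] theorem realize_ballF (a : α ⊕ Fin n) (φ : LSet.BoundedFormula α (n + 1)) :
    (ballF a φ).Realize v xs ↔
      ∀ y : M, y ε Sum.elim v xs a → φ.Realize v (Fin.snoc xs y) := by
  simp [ballF]

@[simp] theorem realize_bexF (a : α ⊕ Fin n) (φ : LSet.BoundedFormula α (n + 1)) :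
    (bexF a φ).Realize v xs ↔
      ∃ y : M, y ε Sum.elim v xs a ∧ φ.Realize v (Fin.snoc xs y) := by
  simp [bexF]

@[simp] theorem realize_subF (a b : α ⊕ Fin n) :
    (subF a b).Realize v xs ↔ Sub (Sum.elim v xs a) (Sum.elim v xs b) := by
  simp [subF, Sub]

@[simp] theorem realize_emptyF (a : α ⊕ Fin n) :
    (emptyF a).Realize v xs ↔ IsEmpt (Sum.elim v xs a) := by
  simp [emptyF, IsEmpt]

@[simp] theorem realize_singF (p a : α ⊕ Fin n) :
    (singF p a).Realize v xs ↔ IsSing (Sum.elim v xs p) (Sum.elim v xs a) := by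
  simp [singF, IsSing]

@[simp] theorem realize_pairF (p a b : α ⊕ Fin n) :
    (pairF p a b).Realize v xs ↔
      IsPair (Sum.elim v xs p) (Sum.elim v xs a) (Sum.elim v xs b) := by
  simp [pairF, IsPair]

@[simp] theorem realize_opairF (p a b : α ⊕ Fin n) :
    (opairF p a b).Realize v xs ↔
      IsOp (Sum.elim v xs p) (Sum.elim v xs a) (Sum.elim v xs b) := by
  simp [opairF, IsOp]

@[simp] theorem realize_succF (s u : α ⊕ Fin n) :
    (succF s u).Realize v xs ↔ IsSucc (Sum.elim v xs s) (Sum.elim v xs u) := by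
  simp [succF, IsSucc]

@[simp] theorem realize_transF (a : α ⊕ Fin n) :
    (transF a).Realize v xs ↔ IsTrans (Sum.elim v xs a) := by
  simp [transF, IsTrans]

@[simp] theorem realize_natF (a : α ⊕ Fin n) :
    (natF a).Realize v xs ↔ IsNat (Sum.elim v xs a) := by
  simp [natF, ordF, zeroOrSuccF, IsNat, ZeroOrSucc]

@[simp] theorem realize_valF (f a b : α ⊕ Fin n) :
    (valF f a b).Realize v xs ↔
      Val (Sum.elim v xs f) (Sum.elim v xs a) (Sum.elim v xs b) := by
  simp [valF, Val]

theorem realize_inst {k m : ℕ} (φ : LSet.Formula (Fin k ⊕ Fin m)) (w : Fin m → Fin k ⊕ Fin n)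
    (z : Fin k → M) :
    (inst φ w).Realize z xs ↔
      φ.Realize (Sum.elim z fun i => Sum.elim z xs (w i)) := by
  unfold inst Formula.Realize
  rw [BoundedFormula.realize_relabel, iff_eq_eq]
  congr 1
  · funext i
    rcases i with i | i
    · simp
    · simp only [Function.comp_apply, Sum.elim_inr]
      cases w i <;> simp
  · exact Subsingleton.elim _ _

@[simp] theorem realize_inst_one {k : ℕ} (φ : LSet.Formula (Fin k ⊕ Fin 1)) (a : Fin k ⊕ Fin n)
    (z : Fin k → M) :
    (inst φ ![a]).Realize z xs ↔ φ.Realize (Sum.elim z ![Sum.elim z xs a]) := by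
  rw [realize_inst]
  have : (fun i => Sum.elim z xs (![a] i)) = ![Sum.elim z xs a] := by
    funext i; fin_cases i; rfl
  rw [this]

@[simp] theorem realize_inst_two {k : ℕ} (φ : LSet.Formula (Fin k ⊕ Fin 2))
    (a b : Fin k ⊕ Fin n) (z : Fin k → M) :
    (inst φ ![a, b]).Realize z xs ↔
      φ.Realize (Sum.elim z ![Sum.elim z xs a, Sum.elim z xs b]) := by
  rw [realize_inst]
  have : (fun i => Sum.elim z xs (![a, b] i)) = ![Sum.elim z xs a, Sum.elim z xs b] := by
    funext i; fin_cases i <;> rfl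
  rw [this]

theorem models_closure {k : ℕ} (φ : LSet.Formula (Fin k)) :
    M ⊨ closure φ ↔ ∀ z : Fin k → M, BoundedFormula.Realize φ z default := by
  unfold closure Sentence.Realize
  rw [BoundedFormula.realize_alls]
  exact forall_congr' fun z => Formula.realize_relabel_sumInr φ

end Realize

/-- The relation `(∀ x ∈ X)(∃ y ∈ Y) R x y ∧ (∀ y ∈ Y)(∃ x ∈ X) R x y`. -/
def Link (R : M → M → Prop) (X Y : M) : Prop :=
  (∀ x, x ε X → ∃ y, y ε Y ∧ R x y) ∧ ∀ y, y ε Y → ∃ x, x ε X ∧ R x y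

/-- `f` is a function with domain `ω` and `f(0) = {b}` such that `f(u)` and `f(u + 1)` are linked
by `R` for all `u ∈ ω`. -/
structure IsPathFamily (R : M → M → Prop) (b f : M) : Prop where
  pairs : ∀ p, p ε f → ∃ x y, IsOp p x y
  unique : ∀ x y z, Val f x y → Val f x z → y = z
  dom : ∀ a, IsNat a ↔ ∃ y, Val f a y
  start : ∃ z X, IsEmpt z ∧ IsSing X b ∧ Val f z X
  step : ∀ u, IsNat u → ∀ s X Y, IsSucc s u → Val f u X → Val f s Y → Link R X Y

theorem realize_deltaOmegaF {k n : ℕ} (φ : LSet.Formula (Fin k ⊕ Fin 2)) (b f : Fin k ⊕ Fin n)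
    (z : Fin k → M) (xs : Fin n → M) :
    (deltaOmegaF φ b f).Realize z xs ↔
      IsPathFamily (fun x y => φ.Realize (Sum.elim z ![x, y]))
        (Sum.elim z xs b) (Sum.elim z xs f) := by
  simp only [deltaOmegaF, funF, domOmegaF, startF, stepF, linkF, BoundedFormula.realize_inf,
    BoundedFormula.realize_all, BoundedFormula.realize_ex, BoundedFormula.realize_imp,
    BoundedFormula.realize_iff, realize_ballF, realize_bexF, realize_opairF, realize_valF,
    realize_eqF, realize_natF, realize_emptyF, realize_singF, realize_succF, realize_inst_two,
    elim_new, elim_up]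
  constructor
  · rintro ⟨⟨h1, h2⟩, h3, ⟨e, X, he, hX, hv⟩, h5⟩
    exact ⟨h1, fun x y z hy hz => h2 x y z ⟨hy, hz⟩, h3, ⟨e, X, he, hX, hv⟩,
      fun u hu s X Y hs hX hY => h5 u hu s X Y ⟨hs, hX, hY⟩⟩
  · rintro ⟨h1, h2, h3, ⟨e, X, he, hX, hv⟩, h5⟩
    exact ⟨⟨h1, fun x y z h => h2 x y z h.1 h.2⟩, h3, ⟨e, X, he, hX, hv⟩,
      fun u hu s X Y h => h5 u hu s X Y h.1 h.2.1 h.2.2⟩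

end Semantics

/-! ### Definable predicates, semantically -/

/-- An environment type over `M`: one of `M`, `M × M`, `(M × M) × M`, …, with its coordinate
projections as variables. Predicates of `m` arguments are predicates on the environment type with
`m` factors. -/
class Env (M X : Type) where
  /-- The coordinate projections. -/
  IsVar : (X → M) → Prop

section Definability

variable {M : Type} {X Y : Type} [Env M X] [Env M Y]

instance : Env M M := ⟨fun t => t = fun x => x⟩

instance : Env M (X × M) := ⟨fun t => (t = fun p => p.2) ∨ ∃ s, Env.IsVar s ∧ t = fun p => s p.1⟩

/-- The terms over an environment type: variables, and elements of `M` used as parameters. -/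
class inductive IsTerm (t : X → M) : Prop
  | var : Env.IsVar t → IsTerm t
  | param (c : M) : (t = fun _ => c) → IsTerm t

/-- A substitution: a map between environment types whose coordinates are terms. -/
class IsSubst (M : Type) {X Y : Type} [Env M X] [Env M Y] (g : X → Y) : Prop where
  var : ∀ t : Y → M, Env.IsVar t → IsTerm fun x => t (g x)

theorem IsTerm.comp {t : Y → M} (ht : IsTerm t) (g : X → Y) [hg : IsSubst M g] :
    IsTerm fun x => t (g x) := by
  rcases ht with h | ⟨c, rfl⟩
  · exact hg.var t h
  · exact .param c rfl

theorem IsTerm.weaken {t : X → M} (ht : IsTerm t) : IsTerm fun p : X × M => t p.1 := by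
  rcases ht with h | ⟨c, rfl⟩
  · exact .var (Or.inr ⟨t, h, rfl⟩)
  · exact .param c rfl

section Terms

-- Unification does not see `p.1.1.2` as a weakening of `p.1.2`, so one instance is given for each
-- depth of the environment.

instance (c : M) : IsTerm fun _ : X => c := .param c rfl
instance : IsTerm fun x : M => x := .var rfl
instance : IsTerm fun p : X × M => p.2 := .var (Or.inl rfl)
instance : IsTerm fun p : M × M => p.1 :=
  IsTerm.weaken (t := fun p : M => p) inferInstance
instance : IsTerm fun p : (X × M) × M => p.1.2 :=
  IsTerm.weaken (t := fun p : X × M => p.2) inferInstance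
instance : IsTerm fun p : (M × M) × M => p.1.1 :=
  IsTerm.weaken (t := fun p : M × M => p.1) inferInstance
instance : IsTerm fun p : ((X × M) × M) × M => p.1.1.2 :=
  IsTerm.weaken (t := fun p : (X × M) × M => p.1.2) inferInstance
instance : IsTerm fun p : ((M × M) × M) × M => p.1.1.1 :=
  IsTerm.weaken (t := fun p : (M × M) × M => p.1.1) inferInstance
instance : IsTerm fun p : (((X × M) × M) × M) × M => p.1.1.1.2 :=
  IsTerm.weaken (t := fun p : ((X × M) × M) × M => p.1.1.2) inferInstance
instance : IsTerm fun p : (((M × M) × M) × M) × M => p.1.1.1.1 :=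
  IsTerm.weaken (t := fun p : ((M × M) × M) × M => p.1.1.1) inferInstance
instance : IsTerm fun p : ((((M × M) × M) × M) × M) × M => p.1.1.1.1.1 :=
  IsTerm.weaken (t := fun p : (((M × M) × M) × M) × M => p.1.1.1.1) inferInstance
instance : IsTerm fun p : (((((M × M) × M) × M) × M) × M) × M => p.1.1.1.1.1.1 :=
  IsTerm.weaken (t := fun p : ((((M × M) × M) × M) × M) × M => p.1.1.1.1.1) inferInstance

instance {t : X → M} [h : IsTerm t] : IsTerm fun p : X × M => t p.1 := h.weaken
instance {t : X → M} [h : IsTerm t] : IsTerm fun p : (X × M) × M => t p.1.1 := h.weaken.weaken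
instance {t : X → M} [h : IsTerm t] : IsTerm fun p : ((X × M) × M) × M => t p.1.1.1 :=
  h.weaken.weaken.weaken

instance (y : Y) : IsSubst M (fun _ : X => y) := ⟨fun t _ => .param (t y) rfl⟩

instance : IsSubst M (fun p : X × M => p.1) := ⟨fun t h => .var (Or.inr ⟨t, h, rfl⟩)⟩

instance : IsSubst M (fun p : ((X × M) × M) × M => p.1.1.1) := ⟨fun t h =>
  IsTerm.weaken (t := fun p : (X × M) × M => t p.1.1)
    (IsTerm.weaken (t := fun p : X × M => t p.1) (.var (Or.inr ⟨t, h, rfl⟩)))⟩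

instance (t : X → M) [h : IsTerm t] : IsSubst M t where
  var := by
    rintro s rfl
    exact h

instance (g : X → Y) (t : X → M) [hg : IsSubst M g] [ht : IsTerm t] :
    IsSubst M (fun x => (g x, t x)) where
  var := by
    rintro s (rfl | ⟨s, hs, rfl⟩)
    · exact ht
    · exact hg.var s hs

instance (g : X → Y) [hg : IsSubst M g] : IsSubst M (fun p : X × M => g p.1) where
  var := fun s hs => (hg.var s hs).weaken

end Terms

/-- A class of predicates on environment types over `M`. -/
abbrev PredClass (M : Type) := ∀ (X : Type) [Env M X], (X → Prop) → Prop

/-- Predicates `∃ u₁ ⋯ ∃ uₘ R` with `R` in `Γ`. -/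
inductive IsExBlock (Γ : PredClass M) : ∀ (X : Type) [Env M X], (X → Prop) → Prop
  | base {X : Type} [Env M X] {R : X → Prop} : Γ X R → IsExBlock Γ X R
  | ex {X : Type} [Env M X] {R : X × M → Prop} :
      IsExBlock Γ (X × M) R → IsExBlock Γ X (fun x => ∃ y, R (x, y))

theorem IsExBlock.mono {Γ Γ' : PredClass M}
    (h : ∀ (X : Type) [Env M X] (R : X → Prop), Γ X R → Γ' X R) {R : X → Prop}
    (hR : IsExBlock Γ X R) : IsExBlock Γ' X R := by
  induction hR with
  | base h' => exact .base (h _ _ h')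
  | ex _ ih => exact .ex ih

theorem IsExBlock.subst {Γ : PredClass M}
    (h : ∀ {X Y : Type} [Env M X] [Env M Y] {R : Y → Prop} (g : X → Y) [IsSubst M g],
      Γ Y R → Γ X fun x => R (g x)) {R : Y → Prop} (hR : IsExBlock Γ Y R) (g : X → Y)
    [IsSubst M g] : IsExBlock Γ X fun x => R (g x) := by
  induction hR generalizing X with
  | base h' => exact .base (h g h')
  | ex _ ih => exact .ex (ih fun p : X × M => (g p.1, p.2))

/-- Prenexing: the block of the first predicate is moved out before that of the second. -/
theorem IsExBlock.and {Γ : PredClass M}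
    (hsub : ∀ {X Y : Type} [Env M X] [Env M Y] {R : Y → Prop} (g : X → Y) [IsSubst M g],
      Γ Y R → Γ X fun x => R (g x))
    (hand : ∀ {X : Type} [Env M X] {R S : X → Prop}, Γ X R → Γ X S → Γ X fun x => R x ∧ S x)
    {R S : X → Prop} (hR : IsExBlock Γ X R) (hS : IsExBlock Γ X S) :
    IsExBlock Γ X fun x => R x ∧ S x := by
  induction hR with
  | base hR =>
    induction hS with
    | base hS => exact .base (hand hR hS)
    | @ex X _ S _ ih =>
      have := (ih (hsub (fun p : X × M => p.1) hR)).ex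
      simpa only [exists_and_left] using this
  | @ex X _ R _ ih =>
    have := (ih (hS.subst hsub fun p : X × M => p.1)).ex
    simpa only [exists_and_right] using this

theorem IsExBlock.or [Nonempty M] {Γ : PredClass M}
    (hsub : ∀ {X Y : Type} [Env M X] [Env M Y] {R : Y → Prop} (g : X → Y) [IsSubst M g],
      Γ Y R → Γ X fun x => R (g x))
    (hor : ∀ {X : Type} [Env M X] {R S : X → Prop}, Γ X R → Γ X S → Γ X fun x => R x ∨ S x)
    {R S : X → Prop} (hR : IsExBlock Γ X R) (hS : IsExBlock Γ X S) :
    IsExBlock Γ X fun x => R x ∨ S x := by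
  induction hR with
  | base hR =>
    induction hS with
    | base hS => exact .base (hor hR hS)
    | @ex X _ S _ ih =>
      have := (ih (hsub (fun p : X × M => p.1) hR)).ex
      simpa only [exists_or, exists_const] using this
  | @ex X _ R _ ih =>
    have := (ih (hS.subst hsub fun p : X × M => p.1)).ex
    simpa only [exists_or, exists_const] using this

variable [LSet.Structure M]

variable (M) in
/-- `Δ₀`-predicates with parameters from `M`. Bounded existential quantification and the other
connectives are derived. -/
inductive IsDelta0 : ∀ (X : Type) [Env M X], (X → Prop) → Prop
  | falsum {X : Type} [Env M X] : IsDelta0 X (fun _ => False)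
  | eq {X : Type} [Env M X] (t s : X → M) : IsTerm t → IsTerm s → IsDelta0 X (fun x => t x = s x)
  | mem {X : Type} [Env M X] (t s : X → M) : IsTerm t → IsTerm s → IsDelta0 X (fun x => t x ε s x)
  | imp {X : Type} [Env M X] {R S : X → Prop} :
      IsDelta0 X R → IsDelta0 X S → IsDelta0 X (fun x => R x → S x)
  | ball {X : Type} [Env M X] (t : X → M) {R : X × M → Prop} :
      IsTerm t → IsDelta0 (X × M) R → IsDelta0 X (fun x => ∀ y, y ε t x → R (x, y))

variable (M) in
/-- `Σₗ`-predicates with parameters from `M`; for `l + 1`, the matrix is the negation of a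
`Σₗ`-predicate. -/
def IsSigma : ℕ → PredClass M
  | 0 => IsDelta0 M
  | l + 1 => IsExBlock fun X _ R => IsSigma l X fun x => ¬ R x

variable (M) in
/-- `Πₗ`-predicates with parameters from `M`: the negations of `Σₗ`-predicates. -/
def IsPi (l : ℕ) (X : Type) [Env M X] (R : X → Prop) : Prop := IsSigma M l X fun x => ¬ R x

variable (M) in
/-- `Δₗ`-predicates with parameters from `M`. -/
def IsDelta (l : ℕ) (X : Type) [Env M X] (R : X → Prop) : Prop := IsSigma M l X R ∧ IsPi M l X R

namespace IsDelta0

variable {R S : X → Prop}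

theorem congr (h : IsDelta0 M X R) (e : ∀ x, R x ↔ S x) : IsDelta0 M X S := by
  rwa [← funext fun x => propext (e x)]

theorem not (h : IsDelta0 M X R) : IsDelta0 M X fun x => ¬ R x := h.imp .falsum

theorem of_not (h : IsDelta0 M X fun x => ¬ R x) : IsDelta0 M X R :=
  h.not.congr fun _ => not_not

theorem or (hR : IsDelta0 M X R) (hS : IsDelta0 M X S) : IsDelta0 M X fun x => R x ∨ S x :=
  (hR.not.imp hS).congr fun _ => by tauto

theorem and (hR : IsDelta0 M X R) (hS : IsDelta0 M X S) : IsDelta0 M X fun x => R x ∧ S x :=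
  (hR.imp hS.not).not.congr fun _ => by tauto

theorem iff (hR : IsDelta0 M X R) (hS : IsDelta0 M X S) : IsDelta0 M X fun x => R x ↔ S x :=
  ((hR.imp hS).and (hS.imp hR)).congr fun _ => by tauto

theorem subst {R : Y → Prop} (h : IsDelta0 M Y R) (g : X → Y) [hg : IsSubst M g] :
    IsDelta0 M X fun x => R (g x) := by
  induction h generalizing X with
  | falsum => exact .falsum
  | eq t s ht hs => exact .eq _ _ (ht.comp g) (hs.comp g)
  | mem t s ht hs => exact .mem _ _ (ht.comp g) (hs.comp g)
  | imp _ _ h1 h2 => exact (h1 g).imp (h2 g)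
  | ball t ht _ ih => exact .ball _ (ht.comp g) (ih fun p : X × M => (g p.1, p.2))

theorem all_mem {t : X → M} [ht : IsTerm t] {R : X → M → Prop}
    (h : IsDelta0 M (X × M) fun p => R p.1 p.2) : IsDelta0 M X fun x => ∀ y, y ε t x → R x y :=
  .ball t ht h

theorem ex_mem {t : X → M} [ht : IsTerm t] {R : X → M → Prop}
    (h : IsDelta0 M (X × M) fun p => R p.1 p.2) : IsDelta0 M X fun x => ∃ y, y ε t x ∧ R x y :=
  (all_mem (t := t) (R := fun x y => ¬ R x y) h.not).not.congr fun _ => by push Not; rfl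

theorem eq' {t s : X → M} [ht : IsTerm t] [hs : IsTerm s] : IsDelta0 M X fun x => t x = s x :=
  .eq t s ht hs

theorem mem' {t s : X → M} [ht : IsTerm t] [hs : IsTerm s] : IsDelta0 M X fun x => t x ε s x :=
  .mem t s ht hs

end IsDelta0

namespace IsSigma

variable {l : ℕ} {R S : X → Prop}

theorem congr (h : IsSigma M l X R) (e : ∀ x, R x ↔ S x) : IsSigma M l X S := by
  rwa [← funext fun x => propext (e x)]

theorem subst {R : Y → Prop} (h : IsSigma M l Y R) (g : X → Y) [hg : IsSubst M g] :
    IsSigma M l X fun x => R (g x) := by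
  induction l generalizing X Y with
  | zero => exact IsDelta0.subst h g
  | succ l ih => exact IsExBlock.subst (fun g _ h => ih h g) h g

theorem of_pi (h : IsPi M l X R) : IsSigma M (l + 1) X R := .base h

theorem ex {R : X → M → Prop} (h : IsSigma M (l + 1) (X × M) fun p => R p.1 p.2) :
    IsSigma M (l + 1) X fun x => ∃ y, R x y := IsExBlock.ex h

theorem not (h : IsSigma M l X R) : IsPi M l X fun x => ¬ R x := h.congr fun _ => not_not.symm

end IsSigma

theorem IsPi.not {l : ℕ} {R : X → Prop} (h : IsPi M l X R) : IsSigma M l X fun x => ¬ R x := h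

theorem IsPi.of_not {l : ℕ} {R : X → Prop} (h : IsSigma M l X fun x => ¬ R x) : IsPi M l X R := h

theorem isSigma_zero_iff {R : X → Prop} : IsSigma M 0 X R ↔ IsDelta0 M X R := Iff.rfl

theorem isPi_zero_iff {R : X → Prop} : IsPi M 0 X R ↔ IsDelta0 M X R :=
  ⟨IsDelta0.of_not, IsDelta0.not⟩

theorem IsPi.congr {l : ℕ} {R S : X → Prop} (h : IsPi M l X R) (e : ∀ x, R x ↔ S x) :
    IsPi M l X S := by
  rwa [← funext fun x => propext (e x)]

theorem IsPi.subst {l : ℕ} {R : Y → Prop} (h : IsPi M l Y R) (g : X → Y) [hg : IsSubst M g] :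
    IsPi M l X fun x => R (g x) := IsSigma.subst (R := fun y => ¬ R y) h g

theorem IsSigma.and_or [Nonempty M] (l : ℕ) :
    (∀ {X : Type} [Env M X] {R S : X → Prop}, IsSigma M l X R → IsSigma M l X S →
      IsSigma M l X fun x => R x ∧ S x) ∧
    (∀ {X : Type} [Env M X] {R S : X → Prop}, IsSigma M l X R → IsSigma M l X S →
      IsSigma M l X fun x => R x ∨ S x) := by
  induction l with
  | zero => exact ⟨IsDelta0.and, IsDelta0.or⟩
  | succ l ih =>
    refine ⟨fun hR hS => IsExBlock.and ?_ ?_ hR hS, fun hR hS => IsExBlock.or ?_ ?_ hR hS⟩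
    · exact fun g _ h => IsPi.subst h g
    · exact fun hR hS => (ih.2 hR hS).congr fun _ => by tauto
    · exact fun g _ h => IsPi.subst h g
    · exact fun hR hS => (ih.1 hR hS).congr fun _ => by tauto

section Connectives

variable {l : ℕ} {R S : X → Prop}

theorem IsSigma.and [Nonempty M] (hR : IsSigma M l X R) (hS : IsSigma M l X S) :
    IsSigma M l X fun x => R x ∧ S x := (IsSigma.and_or l).1 hR hS

theorem IsSigma.or [Nonempty M] (hR : IsSigma M l X R) (hS : IsSigma M l X S) :
    IsSigma M l X fun x => R x ∨ S x := (IsSigma.and_or l).2 hR hS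

theorem IsPi.and [Nonempty M] (hR : IsPi M l X R) (hS : IsPi M l X S) :
    IsPi M l X fun x => R x ∧ S x := (IsSigma.or hR hS).congr fun _ => by tauto

theorem IsPi.or [Nonempty M] (hR : IsPi M l X R) (hS : IsPi M l X S) :
    IsPi M l X fun x => R x ∨ S x := (IsSigma.and hR hS).congr fun _ => by tauto

theorem IsSigma.imp [Nonempty M] (hR : IsPi M l X R) (hS : IsSigma M l X S) :
    IsSigma M l X fun x => R x → S x := (hR.not.or hS).congr fun _ => by tauto

theorem IsPi.imp [Nonempty M] (hR : IsSigma M l X R) (hS : IsPi M l X S) :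
    IsPi M l X fun x => R x → S x := (hR.not.or hS).congr fun _ => by tauto

theorem IsPi.all {R : X → M → Prop} (h : IsPi M (l + 1) (X × M) fun p => R p.1 p.2) :
    IsPi M (l + 1) X fun x => ∀ y, R x y :=
  .of_not ((IsSigma.ex (R := fun x y => ¬ R x y) h.not).congr fun _ => by push Not; rfl)

theorem IsPi.of_sigma (h : IsSigma M l X R) : IsPi M (l + 1) X R := IsSigma.of_pi h.not

theorem IsSigma.succ (l : ℕ) : ∀ {X : Type} [Env M X] {R : X → Prop},
    IsSigma M l X R → IsSigma M (l + 1) X R := by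
  induction l with
  | zero => exact fun h => .of_pi (isPi_zero_iff.2 h)
  | succ l ih => exact fun h => IsExBlock.mono (fun X _ R h => ih h) h

theorem IsSigma.mono {k : ℕ} (h : IsSigma M l X R) (hk : l ≤ k) : IsSigma M k X R := by
  induction hk with
  | refl => exact h
  | step _ ih => exact IsSigma.succ _ ih

theorem IsPi.mono {k : ℕ} (h : IsPi M l X R) (hk : l ≤ k) : IsPi M k X R := IsSigma.mono h hk

theorem IsDelta0.isSigma (h : IsDelta0 M X R) : IsSigma M l X R :=
  (isSigma_zero_iff.2 h).mono (Nat.zero_le l)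

theorem IsDelta0.isPi (h : IsDelta0 M X R) : IsPi M l X R :=
  (isPi_zero_iff.2 h).mono (Nat.zero_le l)

theorem IsPi.isDelta (h : IsPi M l X R) : IsDelta M (l + 1) X R :=
  ⟨.of_pi h, h.mono (Nat.le_succ l)⟩

end Connectives

namespace IsDelta

variable {l : ℕ} {R S : X → Prop}

theorem of_isDelta0 (h : IsDelta0 M X R) : IsDelta M l X R := ⟨h.isSigma, h.isPi⟩

theorem not (h : IsDelta M l X R) : IsDelta M l X fun x => ¬ R x := ⟨h.2.not, h.1.not⟩

theorem congr (h : IsDelta M l X R) (e : ∀ x, R x ↔ S x) : IsDelta M l X S :=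
  ⟨h.1.congr e, h.2.congr e⟩

theorem subst {R : Y → Prop} (h : IsDelta M l Y R) (g : X → Y) [IsSubst M g] :
    IsDelta M l X fun x => R (g x) := ⟨h.1.subst g, h.2.subst g⟩

variable [Nonempty M]

theorem and (hR : IsDelta M l X R) (hS : IsDelta M l X S) : IsDelta M l X fun x => R x ∧ S x :=
  ⟨hR.1.and hS.1, hR.2.and hS.2⟩

theorem or (hR : IsDelta M l X R) (hS : IsDelta M l X S) : IsDelta M l X fun x => R x ∨ S x :=
  ⟨hR.1.or hS.1, hR.2.or hS.2⟩

theorem imp (hR : IsDelta M l X R) (hS : IsDelta M l X S) : IsDelta M l X fun x => R x → S x :=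
  ⟨.imp hR.2 hS.1, .imp hR.1 hS.2⟩

end IsDelta

end Definability

/-! ### Formulae and definable predicates -/

section Translation

variable {M : Type} {X : Type} [Env M X]

theorem IsTerm.snoc {α : Type} {n : ℕ} {ρ : X → α → M} {σ : X → Fin n → M}
    (h : ∀ a, IsTerm fun x => Sum.elim (ρ x) (σ x) a) (a : α ⊕ Fin (n + 1)) :
    IsTerm fun p : X × M => Sum.elim (ρ p.1) (Fin.snoc (σ p.1) p.2 : Fin (n + 1) → M) a := by
  rcases a with a | a
  · exact (h (.inl a)).weaken
  · induction a using Fin.lastCases with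
    | last => simpa using (inferInstance : IsTerm fun p : X × M => p.2)
    | cast i => simpa using (h (.inr i)).weaken

/-- The environment map `ρ` reads each of its coordinates off the parameters `z`, the free
variables or the bound variables. -/
def IsReading {k m n : ℕ} (z : Fin k → M) (ρ : (Fin m → M) → (Fin n → M) → X) : Prop :=
  ∀ t : X → M, Env.IsVar t → ∃ a : (Fin k ⊕ Fin m) ⊕ Fin n,
    ∀ w xs, t (ρ w xs) = Sum.elim (Sum.elim z w) xs a

theorem IsTerm.exists_var {t : X → M} (ht : IsTerm t) : ∃ s : Finset M,
    ∀ ⦃k m n : ℕ⦄ (z : Fin k → M), (∀ c ∈ s, ∃ i, z i = c) →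
      ∀ ρ : (Fin m → M) → (Fin n → M) → X, IsReading z ρ →
        ∃ a : (Fin k ⊕ Fin m) ⊕ Fin n, ∀ w xs, t (ρ w xs) = Sum.elim (Sum.elim z w) xs a := by
  rcases ht with h | ⟨c, rfl⟩
  · exact ⟨∅, fun k m n z _ ρ hρ => hρ t h⟩
  · refine ⟨{c}, fun k m n z hz ρ _ => ?_⟩
    obtain ⟨i, hi⟩ := hz c (Finset.mem_singleton_self c)
    exact ⟨.inl (.inl i), fun w xs => by simp [hi]⟩

theorem IsReading.snoc {k m n : ℕ} {z : Fin k → M} {ρ : (Fin m → M) → (Fin n → M) → X}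
    (h : IsReading z ρ) : IsReading z
      (fun (w : Fin m → M) (xs : Fin (n + 1) → M) => (ρ w (Fin.init xs), xs (Fin.last n))) := by
  rintro t (rfl | ⟨t, ht, rfl⟩)
  · exact ⟨new, fun w xs => by simp [new]⟩
  · obtain ⟨a, ha⟩ := h t ht
    refine ⟨up a, fun w xs => (ha w (Fin.init xs)).trans ?_⟩
    rcases a with a | a <;> simp [up, Fin.init]

theorem exists_enumeration (s : Finset M) : ∃ (k : ℕ) (z : Fin k → M), ∀ c ∈ s, ∃ i, z i = c :=
  ⟨s.card, fun i => (s.equivFin.symm i : M), fun c hc => ⟨s.equivFin ⟨c, hc⟩, by simp⟩⟩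

variable [LSet.Structure M]

theorem isDelta0_realize {α : Type} {n : ℕ} {φ : LSet.BoundedFormula α n} (hφ : Delta0 α n φ)
    (ρ : X → α → M) (σ : X → Fin n → M) (h : ∀ a, IsTerm fun x => Sum.elim (ρ x) (σ x) a) :
    IsDelta0 M X fun x => φ.Realize (ρ x) (σ x) := by
  induction hφ generalizing X with
  | falsum => exact .falsum
  | eq a b => exact (IsDelta0.eq _ _ (h a) (h b)).congr fun x => by simp
  | mem a b => exact (IsDelta0.mem _ _ (h a) (h b)).congr fun x => by simp
  | imp _ _ h1 h2 => exact (h1 ρ σ h).imp (h2 ρ σ h)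
  | @ball n a φ _ ih =>
    have := h a
    exact (IsDelta0.all_mem (t := fun x => Sum.elim (ρ x) (σ x) a)
      (R := fun x y => φ.Realize (ρ x) (Fin.snoc (σ x) y))
      (ih (fun p : X × M => ρ p.1) (fun p : X × M => Fin.snoc (σ p.1) p.2) (IsTerm.snoc h))).congr
      fun x => (realize_ballF ..).symm
  | @bex n a φ _ ih =>
    have := h a
    exact (IsDelta0.ex_mem (t := fun x => Sum.elim (ρ x) (σ x) a)
      (R := fun x y => φ.Realize (ρ x) (Fin.snoc (σ x) y))
      (ih (fun p : X × M => ρ p.1) (fun p : X × M => Fin.snoc (σ p.1) p.2) (IsTerm.snoc h))).congr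
      fun x => (realize_bexF ..).symm

/-- Formulae of the Lévy classes define predicates of the corresponding classes, when their
variables are read as terms over an environment. -/
theorem isSigma_isPi_realize (l : ℕ) : ∀ {X : Type} [Env M X] {α : Type} {n : ℕ}
    {φ : LSet.BoundedFormula α n} (ρ : X → α → M) (σ : X → Fin n → M),
    (∀ a, IsTerm fun x => Sum.elim (ρ x) (σ x) a) →
    (SigmaFml l α n φ → IsSigma M l X fun x => φ.Realize (ρ x) (σ x)) ∧
    (PiFml l α n φ → IsPi M l X fun x => φ.Realize (ρ x) (σ x)) := by
  induction l with
  | zero =>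
    exact fun ρ σ h => ⟨fun hφ => isDelta0_realize hφ ρ σ h,
      fun hφ => isPi_zero_iff.2 (isDelta0_realize hφ ρ σ h)⟩
  | succ l ih =>
    intro X _ α n φ ρ σ h
    refine ⟨fun hφ => ?_, fun hφ => ?_⟩
    · simp only [SigmaFml] at hφ
      induction hφ generalizing X with
      | base hφ => exact .of_pi ((ih ρ σ h).2 hφ)
      | @ex n φ _ ihφ =>
        exact (IsSigma.ex (R := fun x y => φ.Realize (ρ x) (Fin.snoc (σ x) y))
          (ihφ (fun p : X × M => ρ p.1) (fun p : X × M => Fin.snoc (σ p.1) p.2)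
            (IsTerm.snoc h))).congr
          fun x => BoundedFormula.realize_ex.symm
    · simp only [PiFml] at hφ
      induction hφ generalizing X with
      | base hφ => exact .of_sigma ((ih ρ σ h).1 hφ)
      | @all n φ _ ihφ =>
        exact (IsPi.all (R := fun x y => φ.Realize (ρ x) (Fin.snoc (σ x) y))
          (ihφ (fun p : X × M => ρ p.1) (fun p : X × M => Fin.snoc (σ p.1) p.2)
            (IsTerm.snoc h))).congr
          fun x => BoundedFormula.realize_all.symm

/-- `R` is defined by a formula of the class `C`, whichever finite list `z` of parameters that
includes the elements of `s` and whichever variables are used. The freedom in `z` allows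
formulae with different parameters to be combined. -/
def HasFormula (C : FmlClass) (R : X → Prop) (s : Finset M) : Prop :=
  ∀ ⦃k m n : ℕ⦄ (z : Fin k → M), (∀ c ∈ s, ∃ i, z i = c) →
    ∀ ρ : (Fin m → M) → (Fin n → M) → X, IsReading z ρ →
      ∃ φ : LSet.BoundedFormula (Fin k ⊕ Fin m) n, C _ _ φ ∧
        ∀ w xs, φ.Realize (Sum.elim z w) xs ↔ R (ρ w xs)

theorem HasFormula.mono {C : FmlClass} {R : X → Prop} {s s' : Finset M} (h : HasFormula C R s)
    (hs : s ⊆ s') : HasFormula C R s' :=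
  fun _ _ _ z hz => h z fun c hc => hz c (hs hc)

theorem IsDelta0.hasFormula {R : X → Prop} (h : IsDelta0 M X R) :
    ∃ s : Finset M, HasFormula Delta0 R s := by
  classical
  induction h with
  | falsum => exact ⟨∅, fun k m n z hz ρ hρ => ⟨⊥, .falsum, fun _ _ => Iff.rfl⟩⟩
  | eq t s ht hs =>
    obtain ⟨s1, h1⟩ := ht.exists_var
    obtain ⟨s2, h2⟩ := hs.exists_var
    refine ⟨s1 ∪ s2, fun k m n z hz ρ hρ => ?_⟩
    obtain ⟨a, ha⟩ := h1 z (fun c hc => hz c (Finset.mem_union_left _ hc)) ρ hρ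
    obtain ⟨b, hb⟩ := h2 z (fun c hc => hz c (Finset.mem_union_right _ hc)) ρ hρ
    exact ⟨eqF a b, .eq a b, fun w xs => by simp [ha, hb]⟩
  | mem t s ht hs =>
    obtain ⟨s1, h1⟩ := ht.exists_var
    obtain ⟨s2, h2⟩ := hs.exists_var
    refine ⟨s1 ∪ s2, fun k m n z hz ρ hρ => ?_⟩
    obtain ⟨a, ha⟩ := h1 z (fun c hc => hz c (Finset.mem_union_left _ hc)) ρ hρ
    obtain ⟨b, hb⟩ := h2 z (fun c hc => hz c (Finset.mem_union_right _ hc)) ρ hρ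
    exact ⟨memF a b, .mem a b, fun w xs => by simp [ha, hb]⟩
  | imp _ _ h1 h2 =>
    obtain ⟨s1, h1⟩ := h1
    obtain ⟨s2, h2⟩ := h2
    refine ⟨s1 ∪ s2, fun k m n z hz ρ hρ => ?_⟩
    obtain ⟨φ, hφ, h1⟩ := h1.mono Finset.subset_union_left z hz ρ hρ
    obtain ⟨ψ, hψ, h2⟩ := h2.mono Finset.subset_union_right z hz ρ hρ
    exact ⟨φ ⟹ ψ, hφ.imp hψ, fun w xs => by rw [BoundedFormula.realize_imp, h1, h2]⟩
  | ball t ht _ ih =>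
    obtain ⟨s1, h1⟩ := ht.exists_var
    obtain ⟨s2, h2⟩ := ih
    refine ⟨s1 ∪ s2, fun k m n z hz ρ hρ => ?_⟩
    obtain ⟨a, ha⟩ := h1 z (fun c hc => hz c (Finset.mem_union_left _ hc)) ρ hρ
    obtain ⟨φ, hφ, h2⟩ := h2.mono Finset.subset_union_right z hz _ hρ.snoc
    refine ⟨ballF a φ, hφ.ball a, fun w xs => ?_⟩
    simp [ha, h2]

/-- A `Σₗ`-predicate is defined by a `Σₗ`-formula and its negation by a `Πₗ`-formula, with
common parameters. -/
theorem IsSigma.hasFormula (l : ℕ) : ∀ {X : Type} [Env M X] {R : X → Prop}, IsSigma M l X R →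
    ∃ s : Finset M, HasFormula (SigmaFml l) R s ∧ HasFormula (PiFml l) (fun x => ¬ R x) s := by
  classical
  induction l with
  | zero =>
    intro X _ R h
    obtain ⟨s, hs⟩ := IsDelta0.hasFormula h
    obtain ⟨s', hs'⟩ := (IsDelta0.not h).hasFormula
    exact ⟨s ∪ s', hs.mono Finset.subset_union_left, hs'.mono Finset.subset_union_right⟩
  | succ l ih =>
    intro X _ R h
    induction h with
    | base h =>
      obtain ⟨s, hs, hs'⟩ := ih h
      refine ⟨s, fun k m n z hz ρ hρ => ?_, fun k m n z hz ρ hρ => ?_⟩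
      · obtain ⟨φ, hφ, e⟩ := hs' z hz ρ hρ
        exact ⟨φ, .base hφ, fun w xs => (e w xs).trans not_not⟩
      · obtain ⟨φ, hφ, e⟩ := hs z hz ρ hρ
        exact ⟨φ, .base hφ, e⟩
    | ex _ ihR =>
      obtain ⟨s, hs, hs'⟩ := ihR
      refine ⟨s, fun k m n z hz ρ hρ => ?_, fun k m n z hz ρ hρ => ?_⟩
      · obtain ⟨φ, hφ, e⟩ := hs z hz _ hρ.snoc
        exact ⟨∃' φ, .ex hφ, fun w xs => by simp [e]⟩
      · obtain ⟨φ, hφ, e⟩ := hs' z hz _ hρ.snoc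
        exact ⟨∀' φ, .all hφ, fun w xs => by simp [e]⟩

theorem IsPi.hasFormula {l : ℕ} {R : X → Prop} (h : IsPi M l X R) :
    ∃ s : Finset M, HasFormula (PiFml l) R s := by
  obtain ⟨s, -, hs⟩ := IsSigma.hasFormula l h
  refine ⟨s, ?_⟩
  simpa only [not_not] using hs

theorem HasFormula.one {C : FmlClass} {R : M → Prop} {s : Finset M} (h : HasFormula C R s)
    {k : ℕ} (z : Fin k → M) (hz : ∀ c ∈ s, ∃ i, z i = c) :
    ∃ φ : LSet.Formula (Fin k ⊕ Fin 1), C _ _ φ ∧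
      ∀ x, φ.Realize (Sum.elim z ![x]) ↔ R x := by
  obtain ⟨φ, hφ, e⟩ := h z hz (fun (w : Fin 1 → M) (_ : Fin 0 → M) => w 0) (by
    rintro t rfl
    exact ⟨.inl (.inr 0), fun _ _ => rfl⟩)
  exact ⟨φ, hφ, fun x => e ![x] default⟩

theorem HasFormula.two {C : FmlClass} {R : M → M → Prop} {s : Finset M}
    (h : HasFormula C (fun p : M × M => R p.1 p.2) s)
    {k : ℕ} (z : Fin k → M) (hz : ∀ c ∈ s, ∃ i, z i = c) :
    ∃ φ : LSet.Formula (Fin k ⊕ Fin 2), C _ _ φ ∧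
      ∀ x y, φ.Realize (Sum.elim z ![x, y]) ↔ R x y := by
  obtain ⟨φ, hφ, e⟩ := h z hz (fun (w : Fin 2 → M) (_ : Fin 0 → M) => (w 0, w 1)) (by
    rintro t (rfl | ⟨t, rfl, rfl⟩)
    · exact ⟨.inl (.inr 1), fun _ _ => rfl⟩
    · exact ⟨.inl (.inr 0), fun _ _ => rfl⟩)
  exact ⟨φ, hφ, fun x y => e ![x, y] default⟩

end Translation

/-! ### The schemes, for definable predicates -/

section Schemes

variable {M : Type} [LSet.Structure M]

/-- Every predicate of the class `Γ` separates. -/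
def SepFor (Γ : PredClass M) : Prop :=
  ∀ R : M → Prop, Γ M R → ∀ w, ∃ y, ∀ x, x ε y ↔ x ε w ∧ R x

/-- Every relation of the class `Γ` satisfies collection. -/
def CollFor (Γ : PredClass M) : Prop :=
  ∀ R : M → M → Prop, (Γ (M × M) fun p => R p.1 p.2) →
    ∀ w, (∀ x, x ε w → ∃ y, R x y) → ∃ c, ∀ x, x ε w → ∃ y, y ε c ∧ R x y

/-- Every nonempty predicate of the class `Γ` has an `∈`-minimal element. -/
def FoundFor (Γ : PredClass M) : Prop :=
  ∀ R : M → Prop, Γ M R → (∃ x, R x) → ∃ y, R y ∧ ∀ w, w ε y → ¬ R w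

theorem sepFor_of_models (h : M ⊨ Separation Delta0) : SepFor (IsDelta0 M) := by
  intro R hR w
  obtain ⟨s, hs⟩ := hR.hasFormula
  obtain ⟨k, z, hz⟩ := exists_enumeration s
  obtain ⟨φ, hφ, e⟩ := hs.one z hz
  have := (models_closure _).1 (h.realize_of_mem _ ⟨k, φ, hφ, rfl⟩) z
  simpa [e] using this w

theorem collFor_of_hasFormula {Γ : PredClass M} {C : FmlClass} (h : M ⊨ Collection C)
    (hΓ : ∀ R : M × M → Prop, Γ (M × M) R → ∃ s : Finset M, HasFormula C R s) : CollFor Γ := by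
  intro R hR w hw
  obtain ⟨s, hs⟩ := hΓ _ hR
  obtain ⟨k, z, hz⟩ := exists_enumeration s
  obtain ⟨φ, hφ, e⟩ := hs.two z hz
  have := (models_closure _).1 (h.realize_of_mem _ ⟨k, φ, hφ, rfl⟩) z
  simp only [BoundedFormula.realize_all, BoundedFormula.realize_imp, BoundedFormula.realize_ex,
    realize_ballF, realize_bexF, realize_inst_two, elim_new, elim_up, e] at this
  exact this w hw

theorem foundFor_of_hasFormula {Γ : PredClass M} {C : FmlClass} (h : M ⊨ Foundation C)
    (hΓ : ∀ R : M → Prop, Γ M R → ∃ s : Finset M, HasFormula C R s) : FoundFor Γ := by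
  intro R hR hx
  obtain ⟨s, hs⟩ := hΓ _ hR
  obtain ⟨k, z, hz⟩ := exists_enumeration s
  obtain ⟨φ, hφ, e⟩ := hs.one z hz
  have := (models_closure _).1 (h.realize_of_mem _ ⟨k, φ, hφ, rfl⟩) z
  simp only [BoundedFormula.realize_imp, BoundedFormula.realize_ex, BoundedFormula.realize_inf,
    realize_ballF, BoundedFormula.realize_not, realize_inst_one, elim_new, e] at this
  exact this hx

theorem models_foundation_sigma {l : ℕ} (h : FoundFor (IsSigma M l)) {σ : LSet.Sentence}
    (hσ : σ ∈ Foundation (SigmaFml l)) : M ⊨ σ := by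
  obtain ⟨k, φ, hφ, rfl⟩ := hσ
  refine (models_closure _).2 fun z => ?_
  simp only [BoundedFormula.realize_imp, BoundedFormula.realize_ex, BoundedFormula.realize_inf,
    realize_ballF, BoundedFormula.realize_not, realize_inst_one, elim_new]
  refine h _ ((isSigma_isPi_realize l (fun x : M => Sum.elim z ![x]) (fun _ => default) ?_).1 hφ)
  rintro ((i | i) | i)
  · exact .param (z i) rfl
  · fin_cases i
    exact .var rfl
  · exact i.elim0

/-- The conclusion of `Δₗ-WDC_ω`. -/
def WDCFor (l : ℕ) (M : Type) [LSet.Structure M] : Prop :=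
  ∀ R : M → M → Prop, (IsDelta M l (M × M) fun p => R p.1 p.2) → (∀ x, ∃ y, R x y) →
    ∀ b, ∃ f, IsPathFamily R b f

theorem wdcFor_of_models {l : ℕ} (h : M ⊨ DeltaWDC l) : WDCFor l M := by
  classical
  intro R hR htot b
  obtain ⟨s1, h1, -⟩ := IsSigma.hasFormula l hR.1
  obtain ⟨s2, h2⟩ := hR.2.hasFormula
  obtain ⟨k, z, hz⟩ := exists_enumeration (s1 ∪ s2)
  obtain ⟨ψ, hψ, e1⟩ := (h1.mono Finset.subset_union_left).two z hz
  obtain ⟨φ, hφ, e2⟩ := (h2.mono Finset.subset_union_right).two z hz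
  have := (models_closure _).1 (h.realize_of_mem _ ⟨k, φ, ψ, hφ, hψ, rfl⟩) z
  simp only [BoundedFormula.realize_all, BoundedFormula.realize_imp, BoundedFormula.realize_ex,
    BoundedFormula.realize_iff, realize_inst_two, realize_deltaOmegaF, elim_new, elim_up, e1,
    e2] at this
  exact this (fun _ _ => trivial) htot b

theorem models_deltaWDC {l : ℕ} (h : WDCFor l M) {σ : LSet.Sentence} (hσ : σ ∈ DeltaWDC l) :
    M ⊨ σ := by
  obtain ⟨k, φ, ψ, hφ, hψ, rfl⟩ := hσ
  refine (models_closure _).2 fun z => ?_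
  simp only [BoundedFormula.realize_all, BoundedFormula.realize_imp, BoundedFormula.realize_ex,
    BoundedFormula.realize_iff, realize_inst_two, realize_deltaOmegaF, elim_new, elim_up]
  intro he htot b
  refine h _ ?_ htot b
  have ht : ∀ a, IsTerm fun p : M × M =>
      Sum.elim (Sum.elim z ![p.1, p.2]) (default : Fin 0 → M) a := by
    rintro ((i | i) | i)
    · exact .param (z i) rfl
    · fin_cases i
      · exact inferInstanceAs (IsTerm fun p : M × M => p.1)
      · exact inferInstanceAs (IsTerm fun p : M × M => p.2)
    · exact i.elim0
  refine ⟨((isSigma_isPi_realize l (fun p : M × M => Sum.elim z ![p.1, p.2])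
    (fun _ => default) ht).1 hψ).congr fun p => (he p.1 p.2).symm, ?_⟩
  exact (isSigma_isPi_realize l (fun p : M × M => Sum.elim z ![p.1, p.2])
    (fun _ => default) ht).2 hφ

end Schemes

/-! ### Elementary set theory in a structure -/

/-- The axioms common to `KP` and `M` that are used: Extensionality, Emptyset, Pair, Union,
`Δ₀`-Separation and Set-Foundation. -/
class BasicSet (M : Type) [LSet.Structure M] : Prop where
  ext : ∀ x y : M, (∀ z, z ε x ↔ z ε y) → x = y
  empty : ∃ x : M, IsEmpt x
  pair : ∀ x y : M, ∃ p, IsPair p x y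
  union : ∀ x : M, ∃ u, ∀ z, z ε u ↔ ∃ y, y ε x ∧ z ε y
  sep : SepFor (IsDelta0 M)
  found : ∀ z : M, (∃ x, x ε z) → ∃ y, y ε z ∧ ∀ w, w ε y → ¬ w ε z

section Basic

variable {M : Type} [LSet.Structure M] [BasicSet M]

open BasicSet

instance (priority := low) nonempty_of_basicSet : Nonempty M := ⟨(empty (M := M)).choose⟩

/-- The members of a set that satisfy a `Δ₀`-predicate include an `∈`-minimal one. -/
theorem exists_minimal {R : M → Prop} (hR : IsDelta0 M M R) {w x : M} (hx : x ε w) (hRx : R x) :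
    ∃ y, y ε w ∧ R y ∧ ∀ z, z ε y → z ε w → ¬ R z := by
  obtain ⟨s, hs⟩ := sep R hR w
  obtain ⟨y, hy, hmin⟩ := found s ⟨x, (hs x).2 ⟨hx, hRx⟩⟩
  exact ⟨y, ((hs y).1 hy).1, ((hs y).1 hy).2,
    fun z hz hzw hRz => hmin z hz ((hs z).2 ⟨hzw, hRz⟩)⟩

theorem exists_sing (a : M) : ∃ p, IsSing p a := by
  obtain ⟨p, hp⟩ := pair a a
  exact ⟨p, fun z => (hp z).trans (or_self_iff)⟩

theorem not_mem_self (x : M) : ¬ x ε x := by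
  intro h
  obtain ⟨p, hp⟩ := exists_sing x
  obtain ⟨y, hy, hmin⟩ := found p ⟨x, (hp x).2 rfl⟩
  obtain rfl := (hp y).1 hy
  exact hmin y h hy

theorem not_mem_of_mem {x y : M} (h : x ε y) : ¬ y ε x := by
  intro h'
  obtain ⟨p, hp⟩ := pair x y
  obtain ⟨z, hz, hmin⟩ := found p ⟨x, (hp x).2 (.inl rfl)⟩
  rcases (hp z).1 hz with rfl | rfl
  · exact hmin y h' ((hp y).2 (.inr rfl))
  · exact hmin x h ((hp x).2 (.inl rfl))

/-- `x ∪ y` exists. -/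
theorem exists_union_pair (x y : M) : ∃ u, ∀ z, z ε u ↔ z ε x ∨ z ε y := by
  obtain ⟨p, hp⟩ := pair x y
  obtain ⟨u, hu⟩ := BasicSet.union p
  refine ⟨u, fun z => (hu z).trans ⟨?_, ?_⟩⟩
  · rintro ⟨w, hw, hz⟩
    rcases (hp w).1 hw with rfl | rfl
    · exact .inl hz
    · exact .inr hz
  · rintro (h | h)
    · exact ⟨x, (hp x).2 (.inl rfl), h⟩
    · exact ⟨y, (hp y).2 (.inr rfl), h⟩

/-- `x ∪ {a}` exists. -/
theorem exists_insert (x a : M) : ∃ u, ∀ z, z ε u ↔ z ε x ∨ z = a := by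
  obtain ⟨p, hp⟩ := exists_sing a
  obtain ⟨u, hu⟩ := exists_union_pair x p
  exact ⟨u, fun z => by rw [hu, hp]⟩

theorem exists_isSucc (u : M) : ∃ s, IsSucc s u := exists_insert u u

theorem IsSing.unique {p q a : M} (hp : IsSing p a) (hq : IsSing q a) : p = q :=
  ext p q fun z => (hp z).trans (hq z).symm

theorem IsPair.unique {p q a b : M} (hp : IsPair p a b) (hq : IsPair q a b) : p = q :=
  ext p q fun z => (hp z).trans (hq z).symm

theorem IsEmpt.unique {p q : M} (hp : IsEmpt p) (hq : IsEmpt q) : p = q :=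
  ext p q fun z => ⟨fun h => (hp z h).elim, fun h => (hq z h).elim⟩

theorem IsSucc.inj {s u v : M} (hu : IsSucc s u) (hv : IsSucc s v) : u = v := by
  rcases (hv u).1 ((hu u).2 (.inr rfl)) with h | h
  · rcases (hu v).1 ((hv v).2 (.inr rfl)) with h' | h'
    · exact (not_mem_of_mem h h').elim
    · exact h'.symm
  · exact h

theorem IsSucc.mem {s u : M} (hu : IsSucc s u) : u ε s := (hu u).2 (.inr rfl)

theorem exists_isOp (a b : M) : ∃ p, IsOp p a b := by
  obtain ⟨s, hs⟩ := exists_sing a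
  obtain ⟨t, ht⟩ := pair a b
  obtain ⟨p, hp⟩ := pair s t
  refine ⟨p, fun z => (hp z).trans ⟨?_, ?_⟩⟩
  · rintro (rfl | rfl)
    · exact .inl hs
    · exact .inr ht
  · rintro (h | h)
    · exact .inl (h.unique hs)
    · exact .inr (h.unique ht)

theorem IsOp.inj {p a b c d : M} (h : IsOp p a b) (h' : IsOp p c d) : a = c ∧ b = d := by
  obtain ⟨s, hs⟩ := exists_sing a
  obtain ⟨t, ht⟩ := pair a b
  obtain ⟨t', ht'⟩ := pair c d
  have e : a = c := by
    rcases (h' s).1 ((h s).2 (.inl hs)) with h1 | h1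
    · exact (h1 a).1 ((hs a).2 rfl)
    · exact ((hs c).1 ((h1 c).2 (.inl rfl))).symm
  subst e
  refine ⟨rfl, ?_⟩
  have hd : d = a ∨ d = b := by
    rcases (h t').1 ((h' t').2 (.inr ht')) with h1 | h1
    · exact .inl ((h1 d).1 ((ht' d).2 (.inr rfl)))
    · exact (h1 d).1 ((ht' d).2 (.inr rfl))
  have hb : b = a ∨ b = d := by
    rcases (h' t).1 ((h t).2 (.inr ht)) with h1 | h1
    · exact .inl ((h1 b).1 ((ht b).2 (.inr rfl)))
    · exact (h1 b).1 ((ht b).2 (.inr rfl))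
  rcases hb with hb | hb
  · rcases hd with hd | hd
    · exact hb.trans hd.symm
    · exact hd.symm
  · exact hb

/-- Both coordinates of a pair are elements of one of its elements. -/
theorem IsOp.exists_mem {p a b : M} (h : IsOp p a b) : ∃ c, c ε p ∧ a ε c ∧ b ε c := by
  obtain ⟨t, ht⟩ := pair a b
  exact ⟨t, (h t).2 (.inr ht), (ht a).2 (.inl rfl), (ht b).2 (.inr rfl)⟩

theorem exists_op_iff {p : M} {R : M → M → Prop} : (∃ x y, IsOp p x y ∧ R x y) ↔
    ∃ c, c ε p ∧ ∃ x, x ε c ∧ ∃ y, y ε c ∧ (IsOp p x y ∧ R x y) := by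
  constructor
  · rintro ⟨x, y, h, hR⟩
    obtain ⟨c, hc, hx, hy⟩ := h.exists_mem
    exact ⟨c, hc, x, hx, y, hy, h, hR⟩
  · rintro ⟨c, -, x, -, y, -, h, hR⟩
    exact ⟨x, y, h, hR⟩

section Nat

theorem IsEmpt.isNat {a : M} (h : IsEmpt a) : IsNat a :=
  ⟨⟨fun z hz => (h z hz).elim, fun z hz => (h z hz).elim⟩, .inl h, fun z hz => (h z hz).elim⟩

theorem IsNat.of_mem {a b : M} (ha : IsNat a) (hb : b ε a) : IsNat b :=
  ⟨⟨ha.1.2 b hb, fun z hz => ha.1.2 z (ha.1.1 b hb z hz)⟩, ha.2.2 b hb,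
    fun z hz => ha.2.2 z (ha.1.1 b hb z hz)⟩

theorem IsNat.succ {s u : M} (hs : IsSucc s u) (hu : IsNat u) : IsNat s := by
  have hsub : Sub u s := fun z hz => (hs z).2 (.inl hz)
  refine ⟨⟨fun z hz => ?_, fun z hz => ?_⟩, .inr ⟨u, hs.mem, hs⟩, fun z hz => ?_⟩
  · rcases (hs z).1 hz with h | rfl
    · exact fun w hw => hsub w (hu.1.1 z h w hw)
    · exact hsub
  · rcases (hs z).1 hz with h | rfl
    · exact hu.1.2 z h
    · exact hu.1.1
  · rcases (hs z).1 hz with h | rfl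
    · exact hu.2.2 z h
    · exact hu.2.1

theorem IsNat.cases {a : M} (h : IsNat a) : IsEmpt a ∨ ∃ u, u ε a ∧ IsSucc a u := h.2.1

end Nat

namespace IsDelta0

variable {X : Type} [Env M X] {s t u : X → M} [IsTerm s] [IsTerm t] [IsTerm u]

theorem sub : IsDelta0 M X fun x => Sub (s x) (t x) :=
  all_mem (t := s) (R := fun x y => y ε t x) mem'

theorem isEmpt : IsDelta0 M X fun x => IsEmpt (s x) := by
  have : IsDelta0 M X fun x => ∀ z, z ε s x → z ≠ z := by
    apply_rules [all_mem, not, eq']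
  exact this.congr fun x => by simp [IsEmpt]

theorem isSing : IsDelta0 M X fun x => IsSing (s x) (t x) := by
  have : IsDelta0 M X fun x => t x ε s x ∧ ∀ z, z ε s x → z = t x := by
    apply_rules [all_mem, and, mem', eq']
  exact this.congr fun x => by
    unfold IsSing
    grind

theorem isPair : IsDelta0 M X fun x => IsPair (s x) (t x) (u x) := by
  have : IsDelta0 M X fun x => (t x ε s x ∧ u x ε s x) ∧ ∀ z, z ε s x → z = t x ∨ z = u x := by
    apply_rules [all_mem, and, or, mem', eq']
  exact this.congr fun x => by
    unfold IsPair
    grind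

theorem isSucc : IsDelta0 M X fun x => IsSucc (s x) (t x) := by
  have : IsDelta0 M X fun x => (t x ε s x ∧ ∀ z, z ε t x → z ε s x) ∧
      ∀ z, z ε s x → z ε t x ∨ z = t x := by
    apply_rules [all_mem, and, or, mem', eq']
  exact this.congr fun x => by
    unfold IsSucc
    grind

theorem isOp : IsDelta0 M X fun x => IsOp (s x) (t x) (u x) := by
  have : IsDelta0 M X fun x => ((∃ z, z ε s x ∧ IsSing z (t x)) ∧
      ∃ z, z ε s x ∧ IsPair z (t x) (u x)) ∧
      ∀ z, z ε s x → IsSing z (t x) ∨ IsPair z (t x) (u x) := by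
    apply_rules [all_mem, ex_mem, and, or, isSing, isPair]
  refine this.congr fun x => ⟨fun ⟨⟨⟨a, ha, ha'⟩, b, hb, hb'⟩, h⟩ z => ⟨h z, ?_⟩,
    fun h => ⟨⟨?_, ?_⟩, fun z => (h z).1⟩⟩
  · rintro (hz | hz)
    · rwa [hz.unique ha']
    · rwa [hz.unique hb']
  · obtain ⟨a, ha⟩ := exists_sing (t x)
    exact ⟨a, (h a).2 (.inl ha), ha⟩
  · obtain ⟨a, ha⟩ := pair (t x) (u x)
    exact ⟨a, (h a).2 (.inr ha), ha⟩

theorem val : IsDelta0 M X fun x => Val (s x) (t x) (u x) :=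
  ex_mem (t := s) (R := fun x p => IsOp p (t x) (u x)) isOp

theorem ex_op {R : X → M → M → Prop} (h : IsDelta0 M ((X × M) × M) fun p => R p.1.1 p.1.2 p.2) :
    IsDelta0 M X fun x => ∃ a b, IsOp (s x) a b ∧ R x a b := by
  have h' := h.subst fun p : ((X × M) × M) × M => ((p.1.1.1, p.1.2), p.2)
  have : IsDelta0 M X fun x => ∃ c, c ε s x ∧ ∃ a, a ε c ∧ ∃ b, b ε c ∧
      (IsOp (s x) a b ∧ R x a b) := by
    apply_rules [ex_mem, and, isOp, mem']
  exact this.congr fun x => exists_op_iff.symm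

theorem isTrans : IsDelta0 M X fun x => IsTrans (s x) := by
  unfold IsTrans
  apply_rules [all_mem, sub, mem']

theorem zeroOrSucc : IsDelta0 M X fun x => ZeroOrSucc (s x) := by
  unfold ZeroOrSucc
  apply_rules [ex_mem, or, isEmpt, isSucc]

theorem isNat : IsDelta0 M X fun x => IsNat (s x) := by
  unfold IsNat
  exact (isTrans.and (all_mem isTrans)).and (zeroOrSucc.and (all_mem zeroOrSucc))

end IsDelta0

end Basic

/-! ### Bounded quantifiers and collection -/

section Collection

variable {M : Type} [LSet.Structure M] [BasicSet M]

open BasicSet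

/-- Two like quantifiers are contracted by means of an unordered pair. -/
theorem exists₂_iff_exists_mem {R : M → M → Prop} :
    (∃ a b, R a b) ↔ ∃ p, ∃ a, a ε p ∧ ∃ b, b ε p ∧ R a b := by
  constructor
  · rintro ⟨a, b, h⟩
    obtain ⟨p, hp⟩ := pair a b
    exact ⟨p, a, (hp a).2 (.inl rfl), b, (hp b).2 (.inr rfl), h⟩
  · rintro ⟨p, a, -, b, -, h⟩
    exact ⟨a, b, h⟩

variable (M) in
/-- `Πₗ`-predicates are closed under bounded existential quantification. -/
structure PiBounded (l : ℕ) : Prop where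
  ex_mem : ∀ {X : Type} [Env M X] {t : X → M} [IsTerm t] {R : X → M → Prop},
    (IsPi M l (X × M) fun p => R p.1 p.2) → IsPi M l X fun x => ∃ y, y ε t x ∧ R x y

variable {X : Type} [Env M X] {l : ℕ}

theorem PiBounded.sigma_all_mem (h : PiBounded M l) {t : X → M} [IsTerm t] {R : X → M → Prop}
    (hR : IsSigma M l (X × M) fun p => R p.1 p.2) :
    IsSigma M l X fun x => ∀ y, y ε t x → R x y :=
  (h.ex_mem (t := t) (R := fun x y => ¬ R x y) hR.not).not.congr fun x => by push Not; rfl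

theorem IsPi.all_mem {t : X → M} [IsTerm t] {R : X → M → Prop}
    (hR : IsPi M l (X × M) fun p => R p.1 p.2) :
    IsPi M l X fun x => ∀ y, y ε t x → R x y := by
  cases l with
  | zero => exact isPi_zero_iff.2 (.all_mem (isPi_zero_iff.1 hR))
  | succ l => exact .all (R := fun x y => y ε t x → R x y) (.imp (IsDelta0.mem').isSigma hR)

/-- Contraction of the leading block of quantifiers to one quantifier. -/
theorem IsSigma.exists_isPi (h : PiBounded M l) {R : X → Prop} (hR : IsSigma M (l + 1) X R) :
    ∃ S : X → M → Prop, (IsPi M l (X × M) fun p => S p.1 p.2) ∧ ∀ x, R x ↔ ∃ u, S x u := by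
  induction hR with
  | @base X _ R hR =>
    exact ⟨fun x _ => R x, IsPi.subst hR fun p : X × M => p.1, fun x => by simp⟩
  | @ex X _ R _ ih =>
    obtain ⟨S, hS, e⟩ := ih
    refine ⟨fun x p => ∃ a, a ε p ∧ ∃ b, b ε p ∧ S (x, a) b, ?_, fun x => ?_⟩
    · have hS' := hS.subst fun p : ((X × M) × M) × M => ((p.1.1.1, p.1.2), p.2)
      exact h.ex_mem (t := fun p : X × M => p.2)
        (R := fun p a => ∃ b, b ε p.2 ∧ S (p.1, a) b)
        (h.ex_mem (t := fun p : (X × M) × M => p.1.2) (R := fun p b => S (p.1.1, p.2) b) hS')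
    · simp only [e]
      exact exists₂_iff_exists_mem

theorem PiBounded.zero : PiBounded M 0 :=
  ⟨fun hR => isPi_zero_iff.2 (.ex_mem (isPi_zero_iff.1 hR))⟩

/-- Collection moves a bounded universal quantifier inside an existential one:
`∀ y ∈ t, ∃ u, S` is equivalent to `∃ c, ∀ y ∈ t, ∃ u ∈ c, S`. -/
theorem PiBounded.succ (h : PiBounded M l) (hc : CollFor fun X [Env M X] => IsPi M l X) :
    PiBounded M (l + 1) := by
  refine ⟨fun {X} _ t _ R hR => ?_⟩
  obtain ⟨S, hS, e⟩ := IsSigma.exists_isPi h hR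
  have key : IsSigma M (l + 1) X fun x => ∃ c, ∀ y, y ε t x → ∃ u, u ε c ∧ S (x, y) u := by
    refine .ex (R := fun x c => ∀ y, y ε t x → ∃ u, u ε c ∧ S (x, y) u) ?_
    refine .of_pi (IsPi.all_mem (t := fun p : X × M => t p.1)
      (R := fun p y => ∃ u, u ε p.2 ∧ S (p.1, y) u) ?_)
    refine h.ex_mem (t := fun p : (X × M) × M => p.1.2) (R := fun p u => S (p.1.1, p.2) u) ?_
    exact hS.subst fun p : ((X × M) × M) × M => ((p.1.1.1, p.1.2), p.2)
  refine IsPi.of_not (key.congr fun x => ?_)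
  push Not
  have e' : ∀ y, ¬ R x y ↔ ∃ u, S (x, y) u := fun y => e (x, y)
  simp only [e']
  constructor
  · rintro ⟨c, hc⟩ y hy
    obtain ⟨u, -, hu⟩ := hc y hy
    exact ⟨u, hu⟩
  · exact hc (fun y u => S (x, y) u) (hS.subst fun p : M × M => ((x, p.1), p.2)) (t x)

/-- `Πₙ`-Collection yields closure of the `Πₗ`-predicates under bounded quantification for all
`l ≤ n + 1`. -/
theorem piBounded_of_collFor {n : ℕ} (hc : CollFor fun X [Env M X] => IsPi M n X) :
    ∀ l ≤ n + 1, PiBounded M l := by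
  intro l
  induction l with
  | zero => exact fun _ => .zero
  | succ l ih =>
    intro hl
    exact (ih (by omega)).succ fun R hR => hc R (hR.mono (by omega))

theorem IsDelta.all_mem (h : PiBounded M l) {t : X → M} [IsTerm t] {R : X → M → Prop}
    (hR : IsDelta M l (X × M) fun p => R p.1 p.2) :
    IsDelta M l X fun x => ∀ y, y ε t x → R x y :=
  ⟨h.sigma_all_mem hR.1, .all_mem hR.2⟩

theorem IsDelta.ex_mem (h : PiBounded M l) {t : X → M} [IsTerm t] {R : X → M → Prop}
    (hR : IsDelta M l (X × M) fun p => R p.1 p.2) :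
    IsDelta M l X fun x => ∃ y, y ε t x ∧ R x y :=
  (IsDelta.all_mem h (t := t) (R := fun x y => ¬ R x y) hR.not).not.congr fun _ => by
    push Not; rfl

theorem IsPi.ex_op (h : PiBounded M l) {s : X → M} [IsTerm s] {R : X → M → M → Prop}
    (hR : IsPi M l ((X × M) × M) fun p => R p.1.1 p.1.2 p.2) :
    IsPi M l X fun x => ∃ a b, IsOp (s x) a b ∧ R x a b := by
  refine IsPi.congr ?_ fun x => exists_op_iff.symm
  refine h.ex_mem (R := fun x c => ∃ a, a ε c ∧ ∃ b, b ε c ∧ (IsOp (s x) a b ∧ R x a b)) ?_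
  refine h.ex_mem (R := fun (p : X × M) a => ∃ b, b ε p.2 ∧ (IsOp (s p.1) a b ∧ R p.1 a b)) ?_
  refine h.ex_mem (t := fun p : (X × M) × M => p.1.2)
    (R := fun p b => IsOp (s p.1.1) p.2 b ∧ R p.1.1 p.2 b) ?_
  exact (IsDelta0.isOp.isPi).and
    (hR.subst fun p : ((X × M) × M) × M => ((p.1.1.1, p.1.2), p.2))

theorem IsDelta.ex_op (h : PiBounded M l) {s : X → M} [IsTerm s] {R : X → M → M → Prop}
    (hR : IsDelta M l ((X × M) × M) fun p => R p.1.1 p.1.2 p.2) :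
    IsDelta M l X fun x => ∃ a b, IsOp (s x) a b ∧ R x a b := by
  refine IsDelta.congr ?_ fun x => exists_op_iff.symm
  refine .ex_mem h (R := fun x c => ∃ a, a ε c ∧ ∃ b, b ε c ∧ (IsOp (s x) a b ∧ R x a b)) ?_
  refine .ex_mem h (R := fun (p : X × M) a => ∃ b, b ε p.2 ∧ (IsOp (s p.1) a b ∧ R p.1 a b)) ?_
  refine .ex_mem h (t := fun p : (X × M) × M => p.1.2)
    (R := fun p b => IsOp (s p.1.1) p.2 b ∧ R p.1.1 p.2 b) ?_
  exact (IsDelta.of_isDelta0 IsDelta0.isOp).and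
    (hR.subst fun p : ((X × M) × M) × M => ((p.1.1.1, p.1.2), p.2))

end Collection

/-! ### Foundation from weak dependent choice -/

section Foundation

variable {M : Type} [LSet.Structure M] [BasicSet M]

open BasicSet

/-- A counterexample to `Σ`-Foundation one level up would give an endless descent, which dependent
choice turns into a set. -/
theorem foundFor_sigma_succ {n : ℕ} (hb : PiBounded M (n + 1))
    (hf : FoundFor fun X [Env M X] => IsSigma M (n + 1) X) (hw : WDCFor (n + 2) M) :
    FoundFor fun X [Env M X] => IsSigma M (n + 2) X := by
  intro R hR hne
  obtain ⟨S, hS, hRS⟩ := IsSigma.exists_isPi hb hR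
  by_contra hcon
  push Not at hcon
  -- `P p`: `p` is a pair `⟨x, u⟩` in which `u` witnesses `R x`
  let P : M → Prop := fun p => ∃ x u, IsOp p x u ∧ S x u
  have hP : IsPi M (n + 1) M P :=
    .ex_op hb (R := fun _ x u => S x u) (hS.subst fun q : (M × M) × M => (q.1.2, q.2))
  let D : M → M → Prop := fun p q => ∃ x u, IsOp p x u ∧ ∃ y v, IsOp q y v ∧ y ε x
  have hD : IsDelta0 M (M × M) fun p => D p.1 p.2 :=
    .ex_op (s := fun p : M × M => p.1) (R := fun p x _ => ∃ y v, IsOp p.2 y v ∧ y ε x)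
      (.ex_op (s := fun p : ((M × M) × M) × M => p.1.1.2) (R := fun p y _ => y ε p.1.2) .mem')
  let Q : M → M → Prop := fun p q => P p → P q ∧ D p q
  have hQ : IsDelta M (n + 2) (M × M) fun p => Q p.1 p.2 :=
    (hP.subst fun p : M × M => p.1).isDelta.imp
      ((hP.subst fun p : M × M => p.2).isDelta.and (.of_isDelta0 hD))
  have htot : ∀ p, ∃ q, Q p q := by
    intro p
    by_cases hp : P p
    · obtain ⟨x, u, hxu, hSx⟩ := hp
      obtain ⟨y, hy, hRy⟩ := hcon x ((hRS x).2 ⟨u, hSx⟩)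
      obtain ⟨v, hv⟩ := (hRS y).1 hRy
      obtain ⟨q, hq⟩ := exists_isOp y v
      exact ⟨q, fun _ => ⟨⟨y, v, hq, hv⟩, x, u, hxu, y, v, hq, hy⟩⟩
    · exact ⟨p, fun h => (hp h).elim⟩
  obtain ⟨x₀, hx₀⟩ := hne
  obtain ⟨u₀, hu₀⟩ := (hRS x₀).1 hx₀
  obtain ⟨b, hbp⟩ := exists_isOp x₀ u₀
  have hPb : P b := ⟨x₀, u₀, hbp, hu₀⟩
  obtain ⟨f, hfam⟩ := hw Q hQ htot b
  obtain ⟨e, X₀, he, hX₀, heX⟩ := hfam.start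
  -- every vertex on the family of paths satisfies `P`
  have hall : ∀ i X p, IsNat i → Val f i X → p ε X → P p := by
    by_contra hbad
    push Not at hbad
    have hbad' : ∃ i, ∃ X, ∃ p, IsNat i ∧ Val f i X ∧ p ε X ∧ ¬ P p := hbad
    obtain ⟨i, ⟨X, p, hi, hX, hp, hnP⟩, hmin⟩ := hf
      (fun i => ∃ X, ∃ p, IsNat i ∧ Val f i X ∧ p ε X ∧ ¬ P p)
      (.ex (R := fun i X => ∃ p, IsNat i ∧ Val f i X ∧ p ε X ∧ ¬ P p)
        (.ex (R := fun (q : M × M) p => IsNat q.1 ∧ Val f q.1 q.2 ∧ p ε q.2 ∧ ¬ P p)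
          (.and (IsDelta0.isNat.isSigma) (.and (IsDelta0.val.isSigma)
            (.and (IsDelta0.mem'.isSigma) (hP.subst fun q : (M × M) × M => q.2).not))))) hbad'
    rcases hi.cases with h0 | ⟨j, hj, hij⟩
    · obtain rfl := h0.unique he
      obtain rfl := hfam.unique _ _ _ hX heX
      obtain rfl := (hX₀ p).1 hp
      exact hnP hPb
    · have hjn := hi.of_mem hj
      obtain ⟨Y, hY⟩ := (hfam.dom j).1 hjn
      obtain ⟨q, hq, hqp⟩ := (hfam.step j hjn i Y X hij hY hX).2 p hp
      have hPq : P q := by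
        by_contra h
        exact hmin j hj ⟨Y, q, hjn, hY, hq, h⟩
      exact hnP (hqp hPq).1
  -- so the first coordinates of the vertices have no `∈`-minimal element
  obtain ⟨x, ⟨i, X, p, u, hi, hX, hp, hpx⟩, hmin⟩ := hf
    (fun x => ∃ i, ∃ X, ∃ p, ∃ u, IsNat i ∧ Val f i X ∧ p ε X ∧ IsOp p x u)
    (.ex (R := fun x i => ∃ X, ∃ p, ∃ u, IsNat i ∧ Val f i X ∧ p ε X ∧ IsOp p x u)
      (.ex (R := fun (q : M × M) X => ∃ p, ∃ u, IsNat q.2 ∧ Val f q.2 X ∧ p ε X ∧ IsOp p q.1 u)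
        (.ex (R := fun (q : (M × M) × M) p =>
            ∃ u, IsNat q.1.2 ∧ Val f q.1.2 q.2 ∧ p ε q.2 ∧ IsOp p q.1.1 u)
          (.ex (R := fun (q : ((M × M) × M) × M) u =>
              IsNat q.1.1.2 ∧ Val f q.1.1.2 q.1.2 ∧ q.2 ε q.1.2 ∧ IsOp q.2 q.1.1.1 u)
            (IsDelta0.isNat.and (IsDelta0.val.and (IsDelta0.mem'.and IsDelta0.isOp))).isSigma))))
    ⟨x₀, e, X₀, b, u₀, he.isNat, heX, (hX₀ b).2 rfl, hbp⟩
  obtain ⟨j, hj⟩ := exists_isSucc i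
  have hjn := hi.succ hj
  obtain ⟨Y, hY⟩ := (hfam.dom j).1 hjn
  obtain ⟨q, hq, hpq⟩ := (hfam.step i hi j X Y hj hX hY).1 p hp
  obtain ⟨x', u', hpx', y, v, hqy, hyx⟩ := (hpq (hall i X p hi hX hp)).2
  obtain ⟨rfl, -⟩ := hpx.inj hpx'
  exact hmin y hyx ⟨j, Y, q, v, hjn, hY, hq, hqy⟩

end Foundation

/-! ### Separation and collection from `Πₙ`-Collection -/

section Collection

variable {M : Type} [LSet.Structure M] [BasicSet M]

open BasicSet

variable {n : ℕ} (hc : CollFor fun X [Env M X] => IsPi M n X)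

include hc

/-- `Πₙ`-Collection yields `Σₗ`-Separation for `l ≤ n`: a bound for the witnesses is obtained by
collecting, for each `x`, a witness of `∃ u S x u` if there is one, and anything otherwise. -/
theorem sepFor_sigma : ∀ l ≤ n, SepFor fun X [Env M X] => IsSigma M l X := by
  intro l
  induction l with
  | zero => exact fun _ => sep
  | succ l ih =>
    intro hl R hR w
    have hb := piBounded_of_collFor hc l (by omega)
    obtain ⟨S, hS, e⟩ := IsSigma.exists_isPi hb hR
    have hT : IsPi M n (M × M) fun p => S p.1 p.2 ∨ ¬ R p.1 :=
      ((hS.mono (Nat.le_succ l)).or (hR.not.subst fun p : M × M => p.1)).mono hl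
    obtain ⟨c, hcw⟩ := hc (fun x u => S x u ∨ ¬ R x) hT w (fun x _ => by
      by_cases hx : R x
      · obtain ⟨u, hu⟩ := (e x).1 hx
        exact ⟨u, .inl hu⟩
      · exact ⟨x, .inr hx⟩)
    have hB : IsPi M l M fun x => ∃ u, u ε c ∧ S x u := hb.ex_mem (R := fun x u => S x u) hS
    obtain ⟨d, hd⟩ := ih (by omega) _ hB.not w
    obtain ⟨y, hy⟩ := sep (fun x => ¬ x ε d) (.not .mem') w
    refine ⟨y, fun x => (hy x).trans (and_congr_right fun hx => ?_)⟩
    rw [hd, e]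
    constructor
    · intro h
      have : ∃ u, u ε c ∧ S x u := by
        by_contra h'
        exact h ⟨hx, h'⟩
      exact ⟨_, this.choose_spec.2⟩
    · rintro ⟨u, hu⟩ ⟨-, h⟩
      obtain ⟨v, hv, hv'⟩ := hcw x hx
      rcases hv' with hv' | hv'
      · exact h ⟨v, hv, hv'⟩
      · exact hv' ((e x).2 ⟨u, hu⟩)

theorem sepFor_pi {l : ℕ} (hl : l ≤ n) : SepFor fun X [Env M X] => IsPi M l X := by
  intro R hR w
  obtain ⟨d, hd⟩ := sepFor_sigma hc l hl _ hR.not w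
  obtain ⟨y, hy⟩ := sep (fun x => ¬ x ε d) (.not .mem') w
  refine ⟨y, fun x => (hy x).trans (and_congr_right fun hx => ?_)⟩
  rw [hd]
  tauto

/-- `Δₙ₊₁`-Separation: witnesses for the predicate and for its complement are collected together,
which leaves an instance of `Πₙ`-Separation. -/
theorem sepFor_delta : SepFor fun X [Env M X] => IsDelta M (n + 1) X := by
  intro R hR w
  have hb := piBounded_of_collFor hc n (by omega)
  obtain ⟨S, hS, e⟩ := IsSigma.exists_isPi hb hR.1
  obtain ⟨S', hS', e'⟩ := IsSigma.exists_isPi hb hR.2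
  obtain ⟨c, hcw⟩ := hc (fun x u => S x u ∨ S' x u) (hS.or hS') w (fun x _ => by
    by_cases hx : R x
    · obtain ⟨u, hu⟩ := (e x).1 hx
      exact ⟨u, .inl hu⟩
    · obtain ⟨u, hu⟩ := (e' x).1 hx
      exact ⟨u, .inr hu⟩)
  obtain ⟨y, hy⟩ := sepFor_pi hc le_rfl _
    (hb.ex_mem (t := fun _ : M => c) (R := fun x u => S x u) hS) w
  refine ⟨y, fun x => (hy x).trans (and_congr_right fun hx => ?_)⟩
  constructor
  · rintro ⟨u, -, hu⟩
    exact (e x).2 ⟨u, hu⟩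
  · intro hRx
    obtain ⟨u, hu, h | h⟩ := hcw x hx
    · exact ⟨u, hu, h⟩
    · exact ((e' x).2 ⟨u, h⟩ hRx).elim

/-- The value `y` and the witness `u` are collected together, as elements of one set `q`. -/
theorem collFor_sigma : CollFor fun X [Env M X] => IsSigma M (n + 1) X := by
  intro R hR w hw
  have hb := piBounded_of_collFor hc n (by omega)
  obtain ⟨S, hS, e⟩ := IsSigma.exists_isPi hb hR
  have e' : ∀ x y, R x y ↔ ∃ u, S (x, y) u := fun x y => e (x, y)
  have hT : IsPi M n (M × M) fun p => ∃ y, y ε p.2 ∧ ∃ u, u ε p.2 ∧ S (p.1, y) u :=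
    hb.ex_mem (t := fun p : M × M => p.2) (R := fun p y => ∃ u, u ε p.2 ∧ S (p.1, y) u)
      (hb.ex_mem (t := fun p : (M × M) × M => p.1.2) (R := fun p u => S (p.1.1, p.2) u)
        (hS.subst fun p : ((M × M) × M) × M => ((p.1.1.1, p.1.2), p.2)))
  obtain ⟨c, hcw⟩ := hc (fun x q => ∃ y, y ε q ∧ ∃ u, u ε q ∧ S (x, y) u) hT w (fun x hx => by
    obtain ⟨y, hy⟩ := hw x hx
    exact exists₂_iff_exists_mem.1 ⟨y, (e' x y).1 hy⟩)
  obtain ⟨d, hd⟩ := BasicSet.union c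
  refine ⟨d, fun x hx => ?_⟩
  obtain ⟨q, hq, y, hy, u, -, hS⟩ := hcw x hx
  exact ⟨y, (hd y).2 ⟨q, hq, hy⟩, (e' x y).2 ⟨u, hS⟩⟩

/-- The members of a set that satisfy a `Δₙ₊₁`-predicate include an `∈`-minimal one. -/
theorem exists_minimal_delta {R : M → Prop} (hR : IsDelta M (n + 1) M R) {w x : M} (hx : x ε w)
    (hRx : R x) : ∃ y, y ε w ∧ R y ∧ ∀ z, z ε y → z ε w → ¬ R z := by
  obtain ⟨s, hs⟩ := sepFor_delta hc R hR w
  obtain ⟨y, hy, hmin⟩ := found s ⟨x, (hs x).2 ⟨hx, hRx⟩⟩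
  exact ⟨y, ((hs y).1 hy).1, ((hs y).1 hy).2,
    fun z hz hzw hRz => hmin z hz ((hs z).2 ⟨hzw, hRz⟩)⟩

end Collection

/-! ### The cumulative hierarchy -/

section Levels

variable {M : Type} [LSet.Structure M] [BasicSet M]

open BasicSet

/-- `h` is a history: each of its members `x` consists of the subsets of those members of `h` that
belong to `x`. The members of histories are the levels of the cumulative hierarchy; this
presentation of the levels needs neither ordinals nor recursion. -/
def IsHistory (h : M) : Prop := ∀ x, x ε h → ∀ y, y ε x ↔ ∃ c, c ε h ∧ c ε x ∧ Sub y c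

theorem isPi_isHistory {X : Type} [Env M X] {s : X → M} [IsTerm s] :
    IsPi M 1 X fun x => IsHistory (s x) := by
  refine .all_mem (R := fun x z => ∀ y, y ε z ↔ ∃ c, c ε s x ∧ c ε z ∧ Sub y c) ?_
  refine .all (R := fun (p : X × M) y => y ε p.2 ↔ ∃ c, c ε s p.1 ∧ c ε p.2 ∧ Sub y c) ?_
  exact IsDelta0.isPi (IsDelta0.mem'.iff (.ex_mem (IsDelta0.mem'.and .sub)))

variable {h h' x y z : M}

theorem IsHistory.mem_of_sub (hh : IsHistory h) (hx : x ε h) (hzy : Sub z y) (hy : y ε x) :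
    z ε x := by
  obtain ⟨c, hc, hcx, hyc⟩ := (hh x hx y).1 hy
  exact (hh x hx z).2 ⟨c, hc, hcx, fun w hw => hyc w (hzy w hw)⟩

theorem IsHistory.isTrans (hh : IsHistory h) (hx : x ε h) : IsTrans x := by
  by_contra hcon
  obtain ⟨y, hy, hny, hmin⟩ := exists_minimal (R := fun y => ¬ IsTrans y) (.not .isTrans) hx hcon
  refine hny fun z hz w hw => ?_
  obtain ⟨c, hc, hcy, hzc⟩ := (hh y hy z).1 hz
  exact (hh y hy w).2 ⟨c, hc, hcy, not_not.1 (hmin c hcy hc) w (hzc w hw)⟩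

/-- If the earlier levels of a level `x` are comparable with a level `y` that does not belong to
`x`, then `x ⊆ y`. -/
theorem IsHistory.sub_of_forall (hh : IsHistory h) (hh' : IsHistory h') (hx : x ε h) (hy : y ε h')
    (hyx : ¬ y ε x) (hcmp : ∀ u, u ε x → u ε h → u ε y ∨ u = y ∨ y ε u) : Sub x y := by
  intro z hz
  obtain ⟨c, hc, hcx, hzc⟩ := (hh x hx z).1 hz
  rcases hcmp c hcx hc with hu | rfl | hu
  · exact hh'.mem_of_sub hy hzc hu
  · exact (hyx hcx).elim
  · exact (hyx (hh.isTrans hx c hcx y hu)).elim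

theorem IsHistory.comparable (hh : IsHistory h) (hh' : IsHistory h') (hx : x ε h) (hy : y ε h') :
    x ε y ∨ x = y ∨ y ε x := by
  by_contra hcon
  obtain ⟨x, hx, ⟨y, hy, hxy⟩, hminx⟩ := exists_minimal
    (R := fun x => ∃ y, y ε h' ∧ ¬ (x ε y ∨ x = y ∨ y ε x))
    (.ex_mem (t := fun _ => h') (R := fun x y => ¬ (x ε y ∨ x = y ∨ y ε x))
      (.not (IsDelta0.mem'.or (IsDelta0.eq'.or .mem')))) hx ⟨y, hy, hcon⟩
  obtain ⟨y, hy, hxy, hminy⟩ := exists_minimal (R := fun y => ¬ (x ε y ∨ x = y ∨ y ε x))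
      (.not (IsDelta0.mem'.or (IsDelta0.eq'.or .mem'))) hy hxy
  push Not at hxy hminx
  refine hxy.2.1 (ext x y fun z => ⟨?_, ?_⟩)
  · exact hh.sub_of_forall hh' hx hy hxy.2.2 (fun u hu huh => hminx u hu huh y hy) z
  · refine hh'.sub_of_forall hh hy hx hxy.1 (fun u hu huh => ?_) z
    have := not_not.1 (hminy u hu huh)
    tauto

/-- A level that belongs to a member of a history belongs to the history. -/
theorem IsHistory.mem_of_mem (hh : IsHistory h) (hh' : IsHistory h') (hx : x ε h) (hy : y ε h')
    (hxy : x ε y) : x ε h' := by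
  obtain ⟨c, hc, -, hxc⟩ := (hh' y hy x).1 hxy
  obtain ⟨c, hc, hxc, hmin⟩ := exists_minimal (R := fun c => Sub x c) .sub hc hxc
  rcases hh.comparable hh' hx hc with hcx | rfl | hcx
  · obtain ⟨d, hd, hdc, hxd⟩ := (hh' c hc x).1 hcx
    exact (hmin d hdc hd hxd).elim
  · exact hc
  · exact (not_mem_self c (hxc c hcx)).elim

/-- Every set is a subset of a level: the levels that contain the elements of `x` are collected
into one history, to which one more level is added. -/
theorem exists_level {n : ℕ} (hn : 1 ≤ n) (hpow : ∀ x : M, ∃ y, ∀ z, z ε y ↔ Sub z x)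
    (hc : CollFor fun X [Env M X] => IsPi M n X)
    (hf : FoundFor fun X [Env M X] => IsPi M (n + 1) X) (x : M) :
    ∃ h, IsHistory h ∧ ∃ s, s ε h ∧ Sub x s := by
  have hR : IsPi M 1 (M × M) fun p => IsHistory p.2 ∧ ∃ s, s ε p.2 ∧ Sub p.1 s :=
    isPi_isHistory.and (IsDelta0.isPi (.ex_mem .sub))
  by_contra hcon
  obtain ⟨x, hx, hmin⟩ := hf (fun x => ¬ ∃ h, IsHistory h ∧ ∃ s, s ε h ∧ Sub x s)
    (IsSigma.not (.mono (.ex (R := fun x h => IsHistory h ∧ ∃ s, s ε h ∧ Sub x s) (.of_pi hR))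
      (by omega))) ⟨x, hcon⟩
  refine hx ?_
  simp only [not_not] at hmin
  obtain ⟨c, hcx⟩ := hc _ (hR.mono hn) x hmin
  obtain ⟨d, hd⟩ := sepFor_pi hc hn (fun h => IsHistory h) isPi_isHistory c
  obtain ⟨H, hH⟩ := BasicSet.union d
  obtain ⟨U, hU⟩ := BasicSet.union H
  obtain ⟨P, hP⟩ := hpow U
  obtain ⟨S, hS⟩ := sep (fun y => ∃ s, s ε H ∧ Sub y s) (.ex_mem .sub) P
  have hS' : ∀ y, y ε S ↔ ∃ s, s ε H ∧ Sub y s := by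
    refine fun y => (hS y).trans
      ⟨fun h => h.2, fun ⟨s, hs, hys⟩ => ⟨(hP y).2 fun z hz => ?_, s, hs, hys⟩⟩
    exact (hU z).2 ⟨s, hs, hys z hz⟩
  obtain ⟨H', hH'⟩ := exists_insert H S
  refine ⟨H', ?_, S, (hH' S).2 (.inr rfl), fun y hy => ?_⟩
  · intro a ha y
    rcases (hH' a).1 ha with ha | rfl
    · obtain ⟨h, hh, hah⟩ := (hH a).1 ha
      have hhist := ((hd h).1 hh).2
      constructor
      · intro hy
        obtain ⟨c, hc, hca, hyc⟩ := (hhist a hah y).1 hy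
        exact ⟨c, (hH' c).2 (.inl ((hH c).2 ⟨h, hh, hc⟩)), hca, hyc⟩
      · rintro ⟨c, -, hca, hyc⟩
        exact hhist.mem_of_sub hah hyc hca
    · constructor
      · intro hy
        obtain ⟨s, hs, hys⟩ := (hS' y).1 hy
        exact ⟨s, (hH' s).2 (.inl hs), (hS' s).2 ⟨s, hs, fun _ h => h⟩, hys⟩
      · rintro ⟨c, -, hca, hyc⟩
        obtain ⟨s, hs, hcs⟩ := (hS' c).1 hca
        exact (hS' y).2 ⟨s, hs, fun z hz => hcs z (hyc z hz)⟩
  · obtain ⟨h, hh, hhist, s, hs, hys⟩ := hcx y hy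
    exact (hS' y).2 ⟨s, (hH s).2 ⟨h, (hd h).2 ⟨hh, hhist⟩, hs⟩, hys⟩

end Levels

/-! ### Recursion along `ω` -/

section Recursion

variable {M : Type} [LSet.Structure M] [BasicSet M]

open BasicSet

/-- `p = ⟨u + 1, Y⟩` for some `u + 1 ∈ ω` and `Y` with `q = ⟨u, X⟩` and `G X Y`. -/
def RecStep (G : M → M → Prop) (q p : M) : Prop :=
  ∃ u X, IsOp q u X ∧ ∃ s Y, IsOp p s Y ∧ (IsSucc s u ∧ IsNat s ∧ G X Y)

/-- Every member of `g` is the initial pair `p₀` or comes from another member by a step of the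
recursion. A union of such sets is again such a set. -/
def IsRecSet (G : M → M → Prop) (p₀ g : M) : Prop :=
  ∀ p, p ε g → p = p₀ ∨ ∃ q, q ε g ∧ RecStep G q p

theorem isDelta_isRecSet {l : ℕ} (hb : PiBounded M l) {G : M → M → Prop}
    (hG : IsDelta M l (M × M) fun p => G p.1 p.2) (p₀ : M) {X : Type} [Env M X] {s : X → M}
    [IsTerm s] : IsDelta M l X fun x => IsRecSet G p₀ (s x) := by
  refine .all_mem hb (R := fun x p => p = p₀ ∨ ∃ q, q ε s x ∧ RecStep G q p) ?_
  refine .or (.of_isDelta0 .eq') ?_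
  refine .ex_mem hb (t := fun p : X × M => s p.1) (R := fun p q => RecStep G q p.2) ?_
  refine .ex_op hb (s := fun p : (X × M) × M => p.2)
    (R := fun p u x => ∃ s Y, IsOp p.1.2 s Y ∧ (IsSucc s u ∧ IsNat s ∧ G x Y)) ?_
  refine .ex_op hb (s := fun p : (((X × M) × M) × M) × M => p.1.1.1.2)
    (R := fun p s Y => IsSucc s p.1.2 ∧ IsNat s ∧ G p.2 Y) ?_
  refine .and (.of_isDelta0 .isSucc) (.and (.of_isDelta0 .isNat) ?_)
  exact hG.subst fun p : (((((X × M) × M) × M) × M) × M) × M => (p.1.1.2, p.2)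

theorem IsRecSet.cases {G : M → M → Prop} {p₀ g e a u y : M} (hg : IsRecSet G p₀ g)
    (hp₀ : IsOp p₀ e a) (h : Val g u y) :
    (u = e ∧ y = a) ∨ ∃ v x, Val g v x ∧ IsSucc u v ∧ IsNat u ∧ G x y := by
  obtain ⟨p, hp, hpu⟩ := h
  rcases hg p hp with rfl | ⟨q, hq, v, x, hqv, s, Y, hps, hs, hsn, hG⟩
  · exact .inl (hpu.inj hp₀)
  · obtain ⟨rfl, rfl⟩ := hpu.inj hps
    exact .inr ⟨v, x, ⟨q, hq, hqv⟩, hs, hsn, hG⟩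

/-- A total functional `Δₗ`-relation `G` can be iterated along `ω`. -/
theorem exists_recursion {n : ℕ} (hc : CollFor fun X [Env M X] => IsPi M n X)
    (hf : FoundFor fun X [Env M X] => IsPi M (n + 1) X) {ω : M} (hω : ∀ a, a ε ω ↔ IsNat a)
    {G : M → M → Prop} (hG : IsDelta M (n + 1) (M × M) fun p => G p.1 p.2)
    (htot : ∀ x, ∃ y, G x y) (huniq : ∀ x y z, G x y → G x z → y = z) (a : M) :
    ∃ f, (∀ p, p ε f → ∃ x y, IsOp p x y) ∧ (∀ x y z, Val f x y → Val f x z → y = z) ∧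
      (∀ u, IsNat u ↔ ∃ y, Val f u y) ∧ (∃ e, IsEmpt e ∧ Val f e a) ∧
      ∀ s u x y, IsSucc s u → Val f u x → Val f s y → G x y := by
  have hb := piBounded_of_collFor hc (n + 1) le_rfl
  obtain ⟨e, he⟩ := empty (M := M)
  obtain ⟨p₀, hp₀⟩ := exists_isOp e a
  have hsig : IsSigma M (n + 1) (M × M) fun p => IsRecSet G p₀ p.2 ∧ ∃ v, Val p.2 p.1 v :=
    .and (isDelta_isRecSet hb hG p₀).1
      (.ex (R := fun (p : M × M) v => Val p.2 p.1 v) (IsDelta0.val.isSigma))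
  have hex : ∀ u, IsNat u → ∃ g, IsRecSet G p₀ g ∧ ∃ v, Val g u v := by
    by_contra hcon
    push Not at hcon
    have hcon' : ∃ u, IsNat u ∧ ¬ ∃ g, IsRecSet G p₀ g ∧ ∃ v, Val g u v := by
      obtain ⟨u, hu, h⟩ := hcon
      exact ⟨u, hu, fun ⟨g, hg, v, hv⟩ => h g hg v hv⟩
    obtain ⟨u, ⟨hu, hnot⟩, hmin⟩ := hf _ (IsPi.and (IsDelta0.isNat.isPi)
      (IsSigma.not (.ex (R := fun u g => IsRecSet G p₀ g ∧ ∃ v, Val g u v) hsig))) hcon'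
    refine hnot ?_
    rcases hu.cases with h0 | ⟨v, hv, huv⟩
    · obtain rfl := h0.unique he
      obtain ⟨g, hg⟩ := exists_sing p₀
      exact ⟨g, fun p hp => .inl ((hg p).1 hp), a, p₀, (hg p₀).2 rfl, hp₀⟩
    · have : ∃ g, IsRecSet G p₀ g ∧ ∃ x, Val g v x := by
        by_contra h
        exact hmin v hv ⟨hu.of_mem hv, h⟩
      obtain ⟨g, hg, x, q, hq, hqx⟩ := this
      obtain ⟨y, hy⟩ := htot x
      obtain ⟨p, hp⟩ := exists_isOp u y
      obtain ⟨g', hg'⟩ := exists_insert g p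
      refine ⟨g', fun r hr => ?_, y, p, (hg' p).2 (.inr rfl), hp⟩
      rcases (hg' r).1 hr with hr | rfl
      · refine (hg r hr).imp_right fun ⟨q, hq, h⟩ => ⟨q, (hg' q).2 (.inl hq), h⟩
      · exact .inr ⟨q, (hg' q).2 (.inl hq), v, x, hqx, u, y, hp, huv, hu, hy⟩
  obtain ⟨c, hcω⟩ := collFor_sigma hc (fun u g => IsRecSet G p₀ g ∧ ∃ v, Val g u v) hsig ω
    fun u hu => hex u ((hω u).1 hu)
  obtain ⟨d, hd⟩ := sepFor_delta hc (fun g => IsRecSet G p₀ g) (isDelta_isRecSet hb hG p₀) c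
  obtain ⟨f, hff⟩ := BasicSet.union d
  have hfrec : IsRecSet G p₀ f := by
    intro p hp
    obtain ⟨g, hg, hpg⟩ := (hff p).1 hp
    exact (((hd g).1 hg).2 p hpg).imp_right fun ⟨q, hq, h⟩ => ⟨q, (hff q).2 ⟨g, hg, hq⟩, h⟩
  have hdom : ∀ u, IsNat u ↔ ∃ y, Val f u y := by
    refine fun u => ⟨fun hu => ?_, fun ⟨y, hy⟩ => ?_⟩
    · obtain ⟨g, hg, hrec, y, p, hp, hpu⟩ := hcω u ((hω u).2 hu)
      exact ⟨y, p, (hff p).2 ⟨g, (hd g).2 ⟨hg, hrec⟩, hp⟩, hpu⟩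
    · rcases hfrec.cases hp₀ hy with ⟨rfl, -⟩ | ⟨v, x, -, -, hu, -⟩
      · exact he.isNat
      · exact hu
  have hfun : ∀ u y z, Val f u y → Val f u z → y = z := by
    by_contra hcon
    push Not at hcon
    obtain ⟨u, y, z, ⟨p, hp, hpy⟩, ⟨q, hq, hqz⟩, hyz⟩ := hcon
    obtain ⟨u, -, ⟨p, hp, q, hq, u', y, hpy, u'', z, hqz, rfl, rfl, hyz⟩, hmin⟩ := exists_minimal
      (R := fun u => ∃ p, p ε f ∧ ∃ q, q ε f ∧
        ∃ b y, IsOp p b y ∧ ∃ c z, IsOp q c z ∧ (b = u ∧ c = u ∧ y ≠ z))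
      (.ex_mem (R := fun u p => ∃ q, q ε f ∧
          ∃ b y, IsOp p b y ∧ ∃ c z, IsOp q c z ∧ (b = u ∧ c = u ∧ y ≠ z))
        (.ex_mem (R := fun (x : M × M) q =>
            ∃ b y, IsOp x.2 b y ∧ ∃ c z, IsOp q c z ∧ (b = x.1 ∧ c = x.1 ∧ y ≠ z))
          (.ex_op (s := fun x : (M × M) × M => x.1.2) (R := fun x b y =>
              ∃ c z, IsOp x.2 c z ∧ (b = x.1.1 ∧ c = x.1.1 ∧ y ≠ z))
            (.ex_op (s := fun x : (((M × M) × M) × M) × M => x.1.1.2) (R := fun x c z =>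
                x.1.2 = x.1.1.1.1 ∧ c = x.1.1.1.1 ∧ x.2 ≠ z)
              (IsDelta0.eq'.and (IsDelta0.eq'.and (IsDelta0.eq'.not)))))))
      ((hω u).2 ((hdom u).2 ⟨y, p, hp, hpy⟩)) ⟨p, hp, q, hq, u, y, hpy, u, z, hqz, rfl, rfl, hyz⟩
    refine hyz ?_
    rcases hfrec.cases hp₀ ⟨p, hp, hpy⟩ with ⟨rfl, rfl⟩ | ⟨v, x, hvx, huv, hu, hxy⟩
    · rcases hfrec.cases hp₀ ⟨q, hq, hqz⟩ with ⟨-, rfl⟩ | ⟨v, x, -, huv, -⟩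
      · rfl
      · exact (he v huv.mem).elim
    · rcases hfrec.cases hp₀ ⟨q, hq, hqz⟩ with ⟨rfl, rfl⟩ | ⟨v', x', hvx', huv', -, hxz⟩
      · exact (he v huv.mem).elim
      · obtain rfl := huv.inj huv'
        have hxx : x = x' := by
          by_contra hne
          obtain ⟨r, hr, hrx⟩ := hvx
          obtain ⟨r', hr', hrx'⟩ := hvx'
          exact hmin v huv.mem ((hω v).2 (hu.of_mem huv.mem))
            ⟨r, hr, r', hr', v, x, hrx, v, x', hrx', rfl, rfl, hne⟩
        subst hxx
        exact huniq _ _ _ hxy hxz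
  refine ⟨f, fun p hp => ?_, hfun, hdom, ⟨e, he, ?_⟩, fun s u x y hs hx hy => ?_⟩
  · rcases hfrec p hp with rfl | ⟨q, -, u, x, -, s, y, h, -⟩
    · exact ⟨e, a, hp₀⟩
    · exact ⟨s, y, h⟩
  · obtain ⟨y, hy⟩ := (hdom e).1 he.isNat
    rcases hfrec.cases hp₀ hy with ⟨-, rfl⟩ | ⟨v, x, -, hv, -⟩
    · exact hy
    · exact (he v hv.mem).elim
  · rcases hfrec.cases hp₀ hy with ⟨rfl, -⟩ | ⟨v, x', hvx, hsv, -, hG⟩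
    · exact (he u hs.mem).elim
    · obtain rfl := hs.inj hsv
      rwa [hfun _ _ _ hx hvx]

end Recursion

/-! ### Weak dependent choice -/

section WDC

variable {M : Type} [LSet.Structure M] [BasicSet M]

open BasicSet

/-- Every element of `X` is related by `R` to an element of `W`. -/
def Covers (R : M → M → Prop) (x w : M) : Prop := ∀ a, a ε x → ∃ b, b ε w ∧ R a b

/-- `y` is the set of all `R`-successors of elements of `x` in the least level that contains an
`R`-successor of each element of `x`. As initial segments of the hierarchy are coded by
histories, "least" is expressed by a bounded quantifier. -/
def SuccGraph (R : M → M → Prop) (x y : M) : Prop :=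
  ∃ h, ∃ w, IsHistory h ∧ w ε h ∧ (Covers R x w ∧ ∀ v, v ε w → v ε h → ¬ Covers R x v) ∧
    (∀ b, b ε y → b ε w ∧ ∃ a, a ε x ∧ R a b) ∧ ∀ b, b ε w → (∃ a, a ε x ∧ R a b) → b ε y

theorem SuccGraph.link {R : M → M → Prop} {x y : M} (hxy : SuccGraph R x y) : Link R x y := by
  obtain ⟨h, w, -, -, ⟨hcov, -⟩, h1, h2⟩ := hxy
  refine ⟨fun a ha => ?_, fun b hb => (h1 b hb).2⟩
  obtain ⟨b, hb, hR⟩ := hcov a ha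
  exact ⟨b, h2 b hb ⟨a, ha, hR⟩, hR⟩

theorem SuccGraph.unique {R : M → M → Prop} {x y z : M} (hy : SuccGraph R x y)
    (hz : SuccGraph R x z) : y = z := by
  obtain ⟨h, w, hh, hw, ⟨hcov, hmin⟩, h1, h2⟩ := hy
  obtain ⟨h', w', hh', hw', ⟨hcov', hmin'⟩, h1', h2'⟩ := hz
  have : w = w' := by
    rcases hh.comparable hh' hw hw' with hlt | rfl | hlt
    · exact (hmin' w hlt (hh.mem_of_mem hh' hw hw' hlt) hcov).elim
    · rfl
    · exact (hmin w' hlt (hh'.mem_of_mem hh hw' hw hlt) hcov').elim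
  subst this
  exact ext y z fun b => ⟨fun hb => h2' b (h1 b hb).1 (h1 b hb).2,
    fun hb => h2 b (h1' b hb).1 (h1' b hb).2⟩

theorem isDelta_covers {l : ℕ} (hb : PiBounded M l) {R : M → M → Prop}
    (hR : IsDelta M l (M × M) fun p => R p.1 p.2) {X : Type} [Env M X] {s t : X → M}
    [IsTerm s] [IsTerm t] : IsDelta M l X fun x => Covers R (s x) (t x) :=
  .all_mem hb (R := fun x a => ∃ b, b ε t x ∧ R a b)
    (.ex_mem hb (t := fun p : X × M => t p.1) (R := fun p b => R p.2 b)
      (hR.subst fun p : (X × M) × M => (p.1.2, p.2)))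

theorem isSigma_succGraph {n : ℕ} (hn : 1 ≤ n) (hb : PiBounded M (n + 1)) {R : M → M → Prop}
    (hR : IsDelta M (n + 1) (M × M) fun p => R p.1 p.2) :
    IsSigma M (n + 1) (M × M) fun p => SuccGraph R p.1 p.2 := by
  have hex : ∀ {X : Type} [Env M X] {s t : X → M} [IsTerm s] [IsTerm t],
      IsDelta M (n + 1) X fun x => ∃ a, a ε s x ∧ R a (t x) := fun {X} _ {s t} _ _ =>
    .ex_mem hb (R := fun x a => R a (t x)) (hR.subst fun p : X × M => (p.2, t p.1))
  refine .ex (R := fun (p : M × M) h => ∃ w, IsHistory h ∧ w ε h ∧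
    (Covers R p.1 w ∧ ∀ v, v ε w → v ε h → ¬ Covers R p.1 v) ∧
    (∀ b, b ε p.2 → b ε w ∧ ∃ a, a ε p.1 ∧ R a b) ∧
    ∀ b, b ε w → (∃ a, a ε p.1 ∧ R a b) → b ε p.2) ?_
  refine .ex (R := fun (p : (M × M) × M) w => IsHistory p.2 ∧ w ε p.2 ∧
    (Covers R p.1.1 w ∧ ∀ v, v ε w → v ε p.2 → ¬ Covers R p.1.1 v) ∧
    (∀ b, b ε p.1.2 → b ε w ∧ ∃ a, a ε p.1.1 ∧ R a b) ∧
    ∀ b, b ε w → (∃ a, a ε p.1.1 ∧ R a b) → b ε p.1.2) ?_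
  refine .and (.of_pi (isPi_isHistory.mono hn)) (.and (IsDelta0.mem'.isSigma) (.and (.and
    (isDelta_covers hb hR).1 ?_) (.and ?_ ?_)))
  · exact (IsDelta.all_mem hb (t := fun p : ((M × M) × M) × M => p.2)
      (R := fun p v => v ε p.1.2 → ¬ Covers R p.1.1.1 v)
      ((IsDelta.of_isDelta0 .mem').imp (isDelta_covers hb hR).not)).1
  · exact (IsDelta.all_mem hb (t := fun p : ((M × M) × M) × M => p.1.1.2)
      (R := fun p b => b ε p.2 ∧ ∃ a, a ε p.1.1.1 ∧ R a b)
      ((IsDelta.of_isDelta0 .mem').and hex)).1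
  · exact (IsDelta.all_mem hb (t := fun p : ((M × M) × M) × M => p.2)
      (R := fun p b => (∃ a, a ε p.1.1.1 ∧ R a b) → b ε p.1.1.2)
      (hex.imp (IsDelta.of_isDelta0 .mem'))).1

theorem exists_succGraph {n : ℕ} (hn : 1 ≤ n) (hpow : ∀ x : M, ∃ y, ∀ z, z ε y ↔ Sub z x)
    (hc : CollFor fun X [Env M X] => IsPi M n X)
    (hf : FoundFor fun X [Env M X] => IsPi M (n + 1) X) {R : M → M → Prop}
    (hR : IsDelta M (n + 1) (M × M) fun p => R p.1 p.2) (htot : ∀ x, ∃ y, R x y) (x : M) :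
    ∃ y, SuccGraph R x y := by
  have hb := piBounded_of_collFor hc (n + 1) le_rfl
  obtain ⟨c, hcx⟩ := collFor_sigma hc R hR.1 x fun a _ => htot a
  obtain ⟨h, hh, s, hs, hcs⟩ := exists_level hn hpow hc hf c
  have hcov : Covers R x s := fun a ha =>
    let ⟨b, hb, hab⟩ := hcx a ha
    ⟨b, hcs b hb, hab⟩
  obtain ⟨w, hw, hcov, hmin⟩ :=
    exists_minimal_delta hc (R := fun w => Covers R x w) (isDelta_covers hb hR) hs hcov
  obtain ⟨y, hy⟩ := sepFor_delta hc (fun b => ∃ a, a ε x ∧ R a b)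
    (.ex_mem hb (R := fun b a => R a b) (hR.subst fun p : M × M => (p.2, p.1))) w
  exact ⟨y, h, w, hh, hw, ⟨hcov, hmin⟩, fun b => (hy b).1, fun b hb h => (hy b).2 ⟨hb, h⟩⟩

theorem wdcFor_of_collFor {n : ℕ} (hn : 1 ≤ n) (hpow : ∀ x : M, ∃ y, ∀ z, z ε y ↔ Sub z x)
    (hinf : ∃ w : M, ∀ a, IsNat a → a ε w) (hc : CollFor fun X [Env M X] => IsPi M n X)
    (hf : FoundFor fun X [Env M X] => IsPi M (n + 1) X) : WDCFor (n + 1) M := by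
  intro R hR htot b
  have hb := piBounded_of_collFor hc (n + 1) le_rfl
  obtain ⟨w, hw⟩ := hinf
  obtain ⟨ω, hω⟩ := sep (fun a => IsNat a) .isNat w
  have hω' : ∀ a, a ε ω ↔ IsNat a := fun a => (hω a).trans ⟨fun h => h.2, fun h => ⟨hw a h, h⟩⟩
  have hex := exists_succGraph hn hpow hc hf hR htot
  have hS := isSigma_succGraph hn hb hR
  have hG : IsDelta M (n + 1) (M × M) fun p => SuccGraph R p.1 p.2 := by
    -- the complement of the graph of a total function is defined by `∃ z, z = G x ∧ z ≠ y`
    refine ⟨hS, .of_not ((IsSigma.ex (R := fun (p : M × M) z => SuccGraph R p.1 z ∧ z ≠ p.2)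
      (.and (hS.subst fun p : (M × M) × M => (p.1.1, p.2))
        (IsDelta0.eq'.not.isSigma))).congr fun p => ⟨?_, fun h => ?_⟩)⟩
    · rintro ⟨z, hz, hne⟩ h
      exact hne (hz.unique h)
    · obtain ⟨z, hz⟩ := hex p.1
      exact ⟨z, hz, fun e => h (e ▸ hz)⟩
  obtain ⟨X, hX⟩ := exists_sing b
  obtain ⟨f, hpairs, hfun, hdom, ⟨e, he, hv⟩, hstep⟩ := exists_recursion hc hf hω' hG hex
    (fun _ _ _ => SuccGraph.unique) X
  exact ⟨f, hpairs, hfun, hdom, ⟨e, X, he, hX, hv⟩,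
    fun u _ s x y hs hx hy => (hstep s u x y hs hx hy).link⟩

end WDC

/-! ### Models of the two theories -/

section Models

variable {M : Type} [LSet.Structure M]

theorem basicSet_of_models {T : LSet.Theory} [hM : M ⊨ T] (h1 : extensionality ∈ T)
    (h2 : emptyset ∈ T) (h3 : pairing ∈ T) (h4 : union ∈ T) (h5 : Separation Delta0 ⊆ T)
    (hf : ∀ z : M, (∃ x, x ε z) → ∃ y, y ε z ∧ ∀ w, w ε y → ¬ w ε z) : BasicSet M where
  ext := by
    simpa [extensionality, Sentence.Realize, Formula.Realize] using hM.realize_of_mem _ h1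
  empty := by
    simpa [emptyset, Sentence.Realize, Formula.Realize] using hM.realize_of_mem _ h2
  pair := by
    simpa [pairing, Sentence.Realize, Formula.Realize] using hM.realize_of_mem _ h3
  union := by
    simpa [union, Sentence.Realize, Formula.Realize] using hM.realize_of_mem _ h4
  sep := sepFor_of_models (hM.mono h5)
  found := hf

end Models

end LevySet

theorem mainTheorem7 (n : ℕ) (hn : 1 ≤ n) :
    LevySet.Proves
      (LevySet.KP ∪ LevySet.Collection (LevySet.PiFml (n - 1)) ∪
        LevySet.Foundation (LevySet.SigmaFml n) ∪ LevySet.DeltaWDC (n + 1))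
      (LevySet.Foundation (LevySet.SigmaFml (n + 1))) ∧
    LevySet.Proves
      (LevySet.theoryM ∪ LevySet.Collection (LevySet.PiFml n) ∪
        LevySet.Foundation (LevySet.PiFml (n + 1)))
      (LevySet.DeltaWDC (n + 1)) := by
  open LevySet in
  constructor
  · rintro σ hσ M v xs
    obtain ⟨m, rfl⟩ : ∃ m, n = m + 1 := ⟨n - 1, by omega⟩
    have hM : M ⊨ (KP ∪ Collection (PiFml m) ∪ Foundation (SigmaFml (m + 1)) ∪
      DeltaWDC (m + 2)) := M.is_model
    have hfound : FoundFor fun X [Env M X] => IsSigma M (m + 1) X :=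
      foundFor_of_hasFormula (C := SigmaFml (m + 1)) (hM.mono fun _ h => .inl (.inr h))
        fun R hR => (IsSigma.hasFormula _ hR).imp fun _ h => h.1
    have : BasicSet M := basicSet_of_models (hM := hM) (by simp [KP]) (by simp [KP])
      (by simp [KP]) (by simp [KP]) (fun _ h => .inl (.inl (.inl (.inl (.inl (.inr h))))))
      fun z hz => hfound (fun x => x ε z) (IsDelta0.mem'.isSigma) hz
    have hcoll : CollFor fun X [Env M X] => IsPi M m X :=
      collFor_of_hasFormula (C := PiFml m) (hM.mono fun _ h => .inl (.inl (.inr h)))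
        fun R hR => IsPi.hasFormula hR
    have hwdc : WDCFor (m + 2) M := wdcFor_of_models (hM.mono fun _ h => .inr h)
    have := models_foundation_sigma (foundFor_sigma_succ
      (piBounded_of_collFor hcoll (m + 1) le_rfl) hfound hwdc) hσ
    rwa [Subsingleton.elim v default, Subsingleton.elim xs default]
  · rintro σ hσ M v xs
    have hM : M ⊨ (theoryM ∪ Collection (PiFml n) ∪ Foundation (PiFml (n + 1))) := M.is_model
    have hfound : FoundFor fun X [Env M X] => IsPi M (n + 1) X :=
      foundFor_of_hasFormula (C := PiFml (n + 1)) (hM.mono fun _ h => .inr h)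
        fun R hR => IsPi.hasFormula hR
    have : BasicSet M := basicSet_of_models (hM := hM) (by simp [theoryM]) (by simp [theoryM])
      (by simp [theoryM]) (by simp [theoryM]) (fun _ h => .inl (.inl (.inr h)))
      fun z hz => hfound (fun x => x ε z) (IsDelta0.mem'.isPi) hz
    have hcoll : CollFor fun X [Env M X] => IsPi M n X :=
      collFor_of_hasFormula (C := PiFml n) (hM.mono fun _ h => .inl (.inr h))
        fun R hR => IsPi.hasFormula hR
    have hpow : ∀ x : M, ∃ y, ∀ z, z ε y ↔ Sub z x := by
      simpa [powerset, Sentence.Realize, Formula.Realize] using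
        hM.realize_of_mem powerset (by simp [theoryM])
    have hinf : ∃ w : M, ∀ a, IsNat a → a ε w := by
      simpa [infinity, Sentence.Realize, Formula.Realize] using
        hM.realize_of_mem infinity (by simp [theoryM])
    have := models_deltaWDC (wdcFor_of_collFor hn hpow hinf hcoll hfound) hσ
    rwa [Subsingleton.elim v default, Subsingleton.elim xs default]
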